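/- A skew shape $\lambda/\mu$ with $r\ge 0$ rows consists of two weakly decreasing integer sequences $\lambda=(\lambda_1,\dots,\lambda_r)$, $\mu=(\mu_1,\dots,\mu_r)$ with $\mu_i\le\lambda_i$ for all $i$ (parts may be zero or negative); row $i$ has its cells in the columns $\mu_i+1,\dots,\lambda_i$. Let $s_{\lambda/\mu}=s_{\lambda/\mu}(x_1,\dots,x_N)=\sum_T\prod_{c}x_{T(c)}$, the sum being over all semistandard Young tableaux $T$ of shape $\lambda/\mu$ with entries in $\{1,\dots,N\}$ and the product over the cells $c$. The points of $\lambda/\mu$ are the upper points with abscissas $\lambda_i-i$ and the lower points with abscissas $\mu_i-i$, $1\le i\le r$. For a pair of skew shapes $(\lambda/\mu,\sigma/\tau)$ (possibly with different numbers of rows) colour the points of $\lambda/\mu$ green and those of $\sigma/\tau$ red. The points having exactly one of the two colours are the coloured points. Place them on a circle so that clockwise one meets the upper points from left to right and then the lower points from right to left. Green upper and red lower coloured points are oriented inwards, red upper and green lower ones outwards. The orientation is alternating if any two neighbouring coloured points on the circle have different orientations. A noncrossing oriented perfect matching is a perfect matching of the coloured points whose edges, drawn as chords, do not cross and always join an inwards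 with an outwards oriented point. For a nonempty set $S$ of coloured points of the same orientation, the Dodgson recolouring scheme takes such a matching $m$ and reverses all edges of $m$ incident with a point of $S$, i.e. exchanges the colours green and red at all end points of these edges. Let $Q$ be the set of all pairs of skew shapes $(\lambda'/\mu',\sigma'/\tau')$ whose sets of green and red points arise in this way from those of $(\lambda/\mu,\sigma/\tau)$, for some noncrossing oriented perfect matching $m$ (each pair being counted once, even if it arises from several matchings). Theorem. Suppose that the orientation for $(\lambda/\mu,\sigma/\tau)$ is alternating, and fix a nonempty set $S$ of coloured points of the same orientation. Then $Q$ is finite, and for every number $N\ge 0$ of variables $$s_{\lambda/\mu}\cdot s_{\sigma/\tau}=\sum_{(\lambda'/\mu',\,\sigma'/\tau')\in Q}s_{\lambda'/\mu'}\cdot s_{\sigma'/\tau'}.$$ -/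

import Mathlib

namespace SkewOverlay

/-- A skew shape `outer / inner`, given by two weakly decreasing integer sequences of the same
length (the number of rows) with `inner ≤ outer`.  Parts may be zero or negative, and rows may be
empty: the number of rows and the position of the shape are part of the data. -/
structure SkewShape where
  rows : ℕ
  outer : Fin rows → ℤ
  inner : Fin rows → ℤ
  outer_antitone : Antitone outer
  inner_antitone : Antitone inner
  inner_le_outer : ∀ i, inner i ≤ outer i

/-- The cells of a skew shape: row `i` has its cells in the columns `inner i + 1, …, outer i`. -/
abbrev SkewShape.Cell (A : SkewShape) : Type :=
  (i : Fin A.rows) × {j : ℤ // j ∈ Finset.Ioc (A.inner i) (A.outer i)}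

/-- A filling of the cells is semistandard if its rows are weakly increasing and its columns are
strictly increasing (downwards). -/
def SkewShape.IsSemistandard (A : SkewShape) {N : ℕ} (T : A.Cell → Fin N) : Prop :=
  (∀ c d : A.Cell, c.1 = d.1 → c.2.1 ≤ d.2.1 → T c ≤ T d) ∧
  (∀ c d : A.Cell, c.1 < d.1 → c.2.1 = d.2.1 → T c < T d)

open Classical in
/-- The skew Schur function of the shape `A` in `N` variables: the generating function of the
semistandard Young tableaux of shape `A` with entries in an `N`-element alphabet. -/
noncomputable def SkewShape.schur (A : SkewShape) (N : ℕ) : MvPolynomial (Fin N) ℤ :=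
  ∑ T : A.Cell → Fin N with A.IsSemistandard T, ∏ c : A.Cell, MvPolynomial.X (T c)

/-- The points at which lattice paths end (`upper x`, on the top line) or start (`lower x`, on the
bottom line); `x` is the horizontal coordinate. -/
inductive Point where
  | upper (x : ℤ) : Point
  | lower (x : ℤ) : Point

/-- Position on the circle read clockwise: upper points from left to right, followed by the lower
points from right to left. -/
def Point.position : Point → ℤ ⊕ₗ ℤᵒᵈ
  | .upper x => Sum.inlₗ x
  | .lower x => Sum.inrₗ (OrderDual.toDual x)

theorem Point.position_injective : Function.Injective Point.position := by
  intro p q h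
  cases p <;> cases q <;> simp_all [Point.position, Sum.inlₗ, Sum.inrₗ]

/-- The points in clockwise order, the circle being cut at its leftmost place. -/
noncomputable instance : LinearOrder Point := LinearOrder.lift' Point.position
  Point.position_injective

theorem Point.upper_lt_upper {x y : ℤ} : Point.upper x < Point.upper y ↔ x < y :=
  Sum.Lex.inl_lt_inl_iff

theorem Point.lower_lt_lower {x y : ℤ} : Point.lower x < Point.lower y ↔ y < x :=
  Sum.Lex.inr_lt_inr_iff

theorem Point.upper_lt_lower {x y : ℤ} : Point.upper x < Point.lower y :=
  Sum.Lex.inl_lt_inr _ _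

/-- Going clockwise on the circle from `p`, the point `q` is met strictly before `r`
(and the three points are distinct). -/
def Clockwise (p q r : Point) : Prop :=
  (p < q ∧ q < r) ∨ (q < r ∧ r < p) ∨ (r < p ∧ p < q)

/-- The end points of the lattice paths of a skew shape: with rows numbered from 1, the path of
row `i` starts in the lower point `inner i - i` and ends in the upper point `outer i - i`. -/
noncomputable def SkewShape.points (A : SkewShape) : Finset Point :=
  (Finset.univ.image fun i : Fin A.rows => Point.upper (A.outer i - ((i : ℤ) + 1))) ∪
  (Finset.univ.image fun i : Fin A.rows => Point.lower (A.inner i - ((i : ℤ) + 1)))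

/-- A configuration of points together with colours; a point may have both colours. -/
@[ext]
structure Colouring where
  green : Finset Point
  red : Finset Point

/-- The colouring of a pair of shapes: the first shape is green, the second one is red. -/
noncomputable def colouringOf (A B : SkewShape) : Colouring := ⟨A.points, B.points⟩

namespace Colouring

/-- The coloured points: those that have exactly one of the two colours. -/
noncomputable def coloured (c : Colouring) : Finset Point :=
  (c.green \ c.red) ∪ (c.red \ c.green)

/-- The radial orientation: of the coloured points, the green upper and the red lower ones are
oriented inwards, the red upper and the green lower ones outwards. -/
def Inward (c : Colouring) : Point → Prop
  | .upper x => Point.upper x ∈ c.green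
  | .lower x => Point.lower x ∈ c.red

/-- The orientation is alternating: any two coloured points which are neighbours on the circle
have different orientations. -/
def Alternating (c : Colouring) : Prop :=
  ∀ p ∈ c.coloured, ∀ q ∈ c.coloured, p ≠ q → (∀ r ∈ c.coloured, ¬ Clockwise p r q) →
    (c.Inward p ↔ ¬ c.Inward q)

/-- `m` maps every coloured point to its partner in a noncrossing oriented perfect matching: a
perfect matching of the coloured points whose edges, drawn as chords of the circle, do not cross
and connect points of different orientations. -/
structure IsNoncrossingOrientedMatching (c : Colouring) (m : Point → Point) : Prop where
  mem : ∀ p ∈ c.coloured, m p ∈ c.coloured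
  involutive : ∀ p ∈ c.coloured, m (m p) = p
  oriented : ∀ p ∈ c.coloured, (c.Inward p ↔ ¬ c.Inward (m p))
  noncrossing : ∀ p ∈ c.coloured, ∀ q ∈ c.coloured,
    ¬ (Clockwise p q (m p) ∧ Clockwise (m p) (m q) p)

/-- Exchange the two colours at the points of `F` (that is, reverse their orientation). -/
noncomputable def recolour (c : Colouring) (F : Finset Point) : Colouring where
  green := (c.green \ F) ∪ (c.red ∩ F)
  red := (c.red \ F) ∪ (c.green ∩ F)

/-- `c'` arises from `c` by the Dodgson recolouring scheme for the set `S`: for some noncrossing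
oriented perfect matching, all edges incident with a point of `S` are reversed. -/
def DodgsonStep (c : Colouring) (S : Finset Point) (c' : Colouring) : Prop :=
  ∃ m : Point → Point, c.IsNoncrossingOrientedMatching m ∧ c' = c.recolour (S ∪ S.image m)

end Colouring

/-- The set of all pairs of skew shapes whose colouring arises from that of `(A, B)` by the Dodgson
recolouring scheme for `S`. -/
def dodgsonPairs (A B : SkewShape) (S : Finset Point) : Set (SkewShape × SkewShape) :=
  {P | (colouringOf A B).DodgsonStep S (colouringOf P.1 P.2)}

end SkewOverlay

/-!
The proof is algebraic and does not use lattice paths. By the Jacobi-Trudi formula, the skew Schur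
function of a shape is the minor `det (h (u - l))` of a Toeplitz matrix, with rows indexed by the
upper points `u` and columns indexed by the lower points `l` of the shape
(`exists_tableauSum_eq_det`); it is obtained variable by variable, since tableaux
(`tableauSum_branching`) and determinants (`det_branching`) obey the same branching rule. Conversely,
point sets that do not come from a shape have vanishing minors
(`exists_points_eq_of_pointMinor_ne_zero`), so recolourings that are not pairs of shapes may be
added to the sum.

Laplace expansion gives a quadratic relation between products of two minors in which a single point
changes its colour (`sortedMinor_exchange`). Read on the circle, the sign of a term is the parity of
the position of that point (`Colouring.sum_outward_recolour`), so that for an alternating orientation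
it only depends on the orientation of the point. Hence, for a set `W` of points of one orientation
and a set `T` of `#W - 1` points of the other one, reversing `W`, `T` and one more point of the
second orientation gives the same total as reversing `T` and all but one of the points of `W`.
By induction on `W`, the original product is the sum of the products that arise by reversing `W` and
any `#W` points of the opposite orientation (`Colouring.minorProduct_eq_sum_recolour`).

Finally, these are exactly the results of the Dodgson recolouring scheme
(`Colouring.dodgsonStep_iff`): given `S` and equally many points `T` of the opposite orientation,
there is a noncrossing oriented matching that joins `S` with `T`, because as long as points are left,
two neighbours can be joined (`exists_consecutive_iff`).
-/

namespace SkewOverlay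

open Finset

/-! ### Minors in increasing order and the exchange relation -/

section SortedMinor

variable {α β R : Type*} [LinearOrder α] [LinearOrder β] [CommRing R]

/-- The minor of the (possibly infinite) matrix `H` with row set `U` and column set `L`, rows and
columns being taken in increasing order.  It is `0` by convention if `U` and `L` have different
cardinalities. -/
noncomputable def sortedMinor (H : α → β → R) (U : Finset α) (L : Finset β) : R :=
  if h : #U = #L then
    (Matrix.of fun i j : Fin #U => H (U.orderEmbOfFin rfl i) (L.orderEmbOfFin h.symm j)).det
  else 0

theorem sortedMinor_image (H : α → β → R) {k : ℕ} {e : Fin k → α} {f : Fin k → β}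
    (he : StrictMono e) (hf : StrictMono f) :
    sortedMinor H (univ.image e) (univ.image f) = (Matrix.of fun i j => H (e i) (f j)).det := by
  have hU : #(univ.image e) = k := by simp [card_image_of_injective _ he.injective]
  have hL : #(univ.image f) = k := by simp [card_image_of_injective _ hf.injective]
  rw [sortedMinor, dif_pos (hU.trans hL.symm), ← Matrix.det_submatrix_equiv_self (finCongr hU)]
  congr 1
  ext i j
  have h1 := orderEmbOfFin_unique (s := univ.image e) rfl
    (f := fun i => e (finCongr hU i)) (by simp) (fun a b h => he (by simpa using h))
  have h2 := orderEmbOfFin_unique (s := univ.image f) (hL.trans hU.symm)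
    (f := fun i => f (finCongr hU i)) (by simp) (fun a b h => hf (by simpa using h))
  simp only [Matrix.of_apply, Matrix.submatrix_apply, ← h1, ← h2]

theorem sortedMinor_of_card_ne (H : α → β → R) {U : Finset α} {L : Finset β} (h : #U ≠ #L) :
    sortedMinor H U L = 0 :=
  dif_neg h

theorem exists_strictMono_image_eq (U : Finset α) {k : ℕ} (h : #U = k) :
    ∃ e : Fin k → α, StrictMono e ∧ univ.image e = U :=
  ⟨U.orderEmbOfFin h, (U.orderEmbOfFin h).strictMono, by
    apply coe_injective
    simp⟩

theorem sortedMinor_flip (H : α → β → R) (U : Finset α) (L : Finset β) :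
    sortedMinor (fun b a => H a b) L U = sortedMinor H U L := by
  by_cases h : #U = #L
  · generalize hk : #L = k at h
    obtain ⟨e, he, rfl⟩ := exists_strictMono_image_eq U h
    obtain ⟨f, hf, rfl⟩ := exists_strictMono_image_eq L hk
    rw [sortedMinor_image _ hf he, sortedMinor_image _ he hf, ← Matrix.det_transpose]
    rfl
  · rw [sortedMinor_of_card_ne _ h, sortedMinor_of_card_ne _ (Ne.symm h)]

theorem erase_image_succAbove {k : ℕ} {e : Fin (k + 1) → α} (he : StrictMono e) (i : Fin (k + 1)) :
    (univ.image e).erase (e i) = univ.image (e ∘ i.succAbove) := by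
  ext x
  simp only [mem_erase, mem_image, mem_univ, true_and, Function.comp_apply]
  constructor
  · rintro ⟨hne, j, rfl⟩
    obtain ⟨l, rfl⟩ := Fin.exists_succAbove_eq (x := j) (y := i) (fun h => hne (h ▸ rfl))
    exact ⟨l, rfl⟩
  · rintro ⟨l, rfl⟩
    exact ⟨fun h => Fin.succAbove_ne i l (he.injective h), _, rfl⟩

theorem card_filter_lt_image {k : ℕ} {e : Fin k → α} (he : StrictMono e) (i : Fin k) :
    #{x ∈ univ.image e | x < e i} = i := by
  rw [filter_image, card_image_of_injective _ he.injective]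
  simp only [he.lt_iff_lt, filter_gt_eq_Iio, Fin.card_Iio]

/-- Laplace expansion of a minor along the row `u`. -/
theorem sortedMinor_expand_row (H : α → β → R) {U : Finset α} (L : Finset β) {u : α} (hu : u ∈ U) :
    sortedMinor H U L = ∑ l ∈ L, (-1) ^ (#{x ∈ U | x < u} + #{x ∈ L | x < l}) * H u l *
      sortedMinor H (U.erase u) (L.erase l) := by
  by_cases h : #U = #L
  · obtain ⟨k, hk⟩ : ∃ k, #U = k + 1 := ⟨#U - 1, by have := card_pos.2 ⟨u, hu⟩; omega⟩
    obtain ⟨f, hf, rfl⟩ := exists_strictMono_image_eq L (h ▸ hk)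
    obtain ⟨e, he, rfl⟩ := exists_strictMono_image_eq U hk
    obtain ⟨i, -, rfl⟩ := mem_image.1 hu
    rw [sortedMinor_image _ he hf, Matrix.det_succ_row _ i, sum_image (hf.injective.injOn)]
    refine sum_congr rfl fun j _ => ?_
    rw [card_filter_lt_image he, card_filter_lt_image hf, erase_image_succAbove he,
      erase_image_succAbove hf, sortedMinor_image _ (he.comp (Fin.strictMono_succAbove i))
        (hf.comp (Fin.strictMono_succAbove j))]
    rfl
  · rw [sortedMinor_of_card_ne _ h]
    refine (sum_eq_zero fun l hl => ?_).symm
    rw [sortedMinor_of_card_ne, mul_zero]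
    rw [card_erase_of_mem hu, card_erase_of_mem hl]
    have := card_pos.2 ⟨u, hu⟩
    have := card_pos.2 ⟨l, hl⟩
    omega

/-- Expanding along the row `u` a matrix that has `u` among its other rows gives `0`. -/
theorem sum_mul_sortedMinor_of_mem (H : α → β → R) {U : Finset α} (L : Finset β) {u : α}
    (hu : u ∈ U) :
    ∑ l ∈ L, (-1) ^ #{x ∈ L | x < l} * H u l * sortedMinor H U (L.erase l) = 0 := by
  by_cases h : #L = #U + 1
  · obtain ⟨f, hf, rfl⟩ := exists_strictMono_image_eq L h
    generalize hk : #U = k at f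
    obtain ⟨e, he, rfl⟩ := exists_strictMono_image_eq U hk
    obtain ⟨i, -, rfl⟩ := mem_image.1 hu
    have h0 : (Matrix.of fun a b => H ((Fin.cons (e i) e : Fin (k + 1) → α) a) (f b)).det = 0 :=
      Matrix.det_zero_of_row_eq (i := 0) (j := i.succ) (Fin.succ_ne_zero i).symm (by ext; simp)
    rw [sum_image (hf.injective.injOn), ← h0, Matrix.det_succ_row_zero]
    refine sum_congr rfl fun j _ => ?_
    rw [card_filter_lt_image hf, erase_image_succAbove hf,
      sortedMinor_image _ he (hf.comp (Fin.strictMono_succAbove j))]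
    rfl
  · refine sum_eq_zero fun l hl => ?_
    rw [sortedMinor_of_card_ne, mul_zero]
    rw [card_erase_of_mem hl]
    have := card_pos.2 ⟨l, hl⟩
    omega

theorem filter_insert_lt_self (U : Finset α) (u : α) :
    {x ∈ insert u U | x < u} = {x ∈ U | x < u} := by
  simp [filter_insert]

/-- Adjoining the row `u` to a minor: the expansion along the new row, valid also if `u` is
already a row. -/
theorem sum_mul_sortedMinor (H : α → β → R) (U : Finset α) (L : Finset β) (u : α) :
    ∑ l ∈ L, (-1) ^ #{x ∈ L | x < l} * H u l * sortedMinor H U (L.erase l) =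
      if u ∈ U then 0 else (-1) ^ #{x ∈ U | x < u} * sortedMinor H (insert u U) L := by
  split_ifs with hu
  · exact sum_mul_sortedMinor_of_mem H L hu
  · rw [sortedMinor_expand_row H L (mem_insert_self u U), mul_sum]
    refine sum_congr rfl fun l _ => ?_
    rw [filter_insert_lt_self, erase_insert hu, pow_add]
    have h1 : ((-1 : R) ^ #{x ∈ U | x < u}) * (-1) ^ #{x ∈ U | x < u} = 1 := by
      rw [← mul_pow]; simp
    linear_combination (-(-1) ^ #{x ∈ L | x < l} * H u l * sortedMinor H U (L.erase l)) * h1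

/-- The exchange relation for products of two minors: a row of the second minor moves to the
first one, or a column of the first minor moves to the second one.  Both sides are equal to
`∑ u ∈ U', ∑ l ∈ L, ± H u l * [U, L \ l] * [U' \ u, L']`. -/
theorem sortedMinor_exchange (H : α → β → R) (U U' : Finset α) (L L' : Finset β) :
    ∑ u ∈ U' \ U, (-1) ^ (#{x ∈ U | x < u} + #{x ∈ U' | x < u}) *
        (sortedMinor H (insert u U) L * sortedMinor H (U'.erase u) L') =
      ∑ l ∈ L \ L', (-1) ^ (#{x ∈ L | x < l} + #{x ∈ L' | x < l}) *
        (sortedMinor H U (L.erase l) * sortedMinor H U' (insert l L')) := by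
  have key : ∀ u, ∑ l ∈ L, (-1) ^ #{x ∈ L | x < l} * H u l * sortedMinor H U (L.erase l) =
      if u ∈ U then 0 else (-1) ^ #{x ∈ U | x < u} * sortedMinor H (insert u U) L :=
    sum_mul_sortedMinor H U L
  have key' : ∀ l, ∑ u ∈ U', (-1) ^ #{x ∈ U' | x < u} * H u l * sortedMinor H (U'.erase u) L' =
      if l ∈ L' then 0 else (-1) ^ #{x ∈ L' | x < l} * sortedMinor H U' (insert l L') := by
    intro l
    have := sum_mul_sortedMinor (fun b a => H a b) L' U' l
    simpa only [sortedMinor_flip] using this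
  trans ∑ u ∈ U', (-1) ^ #{x ∈ U' | x < u} * sortedMinor H (U'.erase u) L' *
    ∑ l ∈ L, (-1) ^ #{x ∈ L | x < l} * H u l * sortedMinor H U (L.erase l)
  · simp only [key, sdiff_eq_filter, sum_filter]
    refine sum_congr rfl fun u _ => ?_
    by_cases hu : u ∈ U <;> simp only [hu, not_true, not_false_eq_true, if_true, if_false] <;> ring
  trans ∑ l ∈ L, (-1) ^ #{x ∈ L | x < l} * sortedMinor H U (L.erase l) *
    ∑ u ∈ U', (-1) ^ #{x ∈ U' | x < u} * H u l * sortedMinor H (U'.erase u) L'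
  · simp only [mul_sum]
    rw [sum_comm]
    refine sum_congr rfl fun l _ => sum_congr rfl fun u _ => ?_
    ring
  · simp only [key', sdiff_eq_filter, sum_filter]
    refine sum_congr rfl fun l _ => ?_
    by_cases hl : l ∈ L' <;> simp only [hl, not_true, not_false_eq_true, if_true, if_false] <;> ring

end SortedMinor

/-! ### Branching of Toeplitz determinants -/

section Determinants

variable {R : Type*} [CommRing R]

/-- A determinant vanishes if the matrix has a zero block that reaches from the lower left corner
to the diagonal. -/
theorem det_eq_zero_of_corner {r : ℕ} (M : Matrix (Fin r) (Fin r) R) (k : Fin r)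
    (h : ∀ i j, k ≤ i → j ≤ k → M i j = 0) : M.det = 0 := by
  rw [Matrix.det_apply]
  refine sum_eq_zero fun σ _ => ?_
  obtain ⟨i, hi, hσ⟩ : ∃ i ≤ k, k ≤ σ i := by
    by_contra! hcon
    have := card_le_card_of_injOn (s := Iic k) (t := Iio k) σ
      (fun i hi => by simpa using hcon i (by simpa using hi)) σ.injective.injOn
    simp at this
  have h0 : ∏ i, M (σ i) i = 0 := prod_eq_zero (mem_univ i) (h _ _ hσ hi)
  rw [h0, smul_zero]

/-- Subtracting from every row a multiple of the next one does not change a determinant. -/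
theorem det_eq_of_forall_row_eq_add_mul_next {r : ℕ} (A B : Matrix (Fin r) (Fin r) R)
    (c : Fin r → R)
    (h : ∀ i j, A i j = B i j + c i * if hi : (i : ℕ) + 1 < r then A ⟨i + 1, hi⟩ j else 0) :
    A.det = B.det := by
  cases r with
  | zero => simp
  | succ n =>
    rw [← Matrix.det_submatrix_equiv_self Fin.revPerm A,
      ← Matrix.det_submatrix_equiv_self Fin.revPerm B]
    refine Matrix.det_eq_of_forall_row_eq_smul_add_pred (fun i => c i.succ.rev) ?_ ?_
    · intro j
      simp [h (Fin.last n)]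
    · intro i j
      have hi : ((i.succ.rev : Fin (n + 1)) : ℕ) + 1 < n + 1 := by
        have := i.2
        rw [Fin.val_rev, Fin.val_succ]; omega
      have hi' : (⟨((i.succ.rev : Fin (n + 1)) : ℕ) + 1, hi⟩ : Fin (n + 1)) =
          (Fin.castSucc i).rev := by
        ext; simp [Fin.val_rev]; omega
      have := h i.succ.rev j.rev
      rw [dif_pos hi, hi'] at this
      simpa using this

/-- Multilinear expansion of a determinant whose rows are linear combinations. -/
theorem det_sum_rows {r : ℕ} {ι : Type*} (s : Fin r → Finset ι) (w : Fin r → ι → R)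
    (M : Fin r → ι → Fin r → R) :
    (Matrix.of fun i j => ∑ v ∈ s i, w i v * M i v j).det =
      ∑ v ∈ Fintype.piFinset s, (∏ i, w i (v i)) * (Matrix.of fun i j => M i (v i) j).det := by
  have h1 : (Matrix.of fun i j => ∑ v ∈ s i, w i v * M i v j) =
      fun i => ∑ v ∈ s i, w i v • M i v := by
    ext i j; simp
  rw [h1]
  have := (Matrix.detRowAlternating (n := Fin r) (R := R)).toMultilinearMap.map_sum_finset
    (fun i v => w i v • M i v) s
  refine this.trans (sum_congr rfl fun v _ => ?_)
  exact (Matrix.detRowAlternating (n := Fin r) (R := R)).toMultilinearMap.map_smul_univ _ _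

end Determinants

section JacobiTrudi

variable {R : Type*} [CommRing R] {r : ℕ}

/-- The lower bound for row `i` in a sequence `ν` such that `outer / ν` is a horizontal strip: the
next part of `outer`, or the last part of `inner` in the last row. -/
def stripBound (outer inner : Fin r → ℤ) (i : Fin r) : ℤ :=
  if h : (i : ℕ) + 1 < r then outer ⟨i + 1, h⟩ else inner i

theorem le_of_mem_strip {outer inner ν : Fin r → ℤ} (ho : Antitone outer)
    (hν : ∀ i, stripBound outer inner i ≤ ν i) {i j : Fin r} (hij : i < j) : outer j ≤ ν i := by
  have hi := hν i
  have hij' : (i : ℕ) < j := hij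
  rw [stripBound, dif_pos (by omega)] at hi
  exact (ho (Fin.mk_le_of_le_val (by simpa using hij'))).trans hi

/-- Solving the recursion `f' k = f k + z * f' (k - 1)` downwards from `m` to `a`. -/
theorem eq_sum_Ioc_of_recursion {f f' : ℤ → R} {z : R} (hf : ∀ k, f' k = f k + z * f' (k - 1))
    (a m : ℤ) (h : a ≤ m) :
    f' m = ∑ v ∈ Ioc a m, z ^ (m - v).toNat * f v + z ^ (m - a).toNat * f' a := by
  induction m, h using Int.leInduction with
  | base => simp
  | succ m hm ih =>
    have h1 : Ioc a (m + 1) = insert (m + 1) (Ioc a m) := by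
      ext x; simp only [mem_Ioc, mem_insert]; omega
    have h2 : ∀ v ≤ m, (m + 1 - v).toNat = (m - v).toNat + 1 := by intro v hv; omega
    rw [hf, h1, sum_insert (by simp), add_sub_cancel_right, ih, h2 a hm, mul_add, mul_sum]
    have h3 : ∑ v ∈ Ioc a m, z ^ (m + 1 - v).toNat * f v =
        ∑ v ∈ Ioc a m, z * (z ^ (m - v).toNat * f v) := by
      refine sum_congr rfl fun v hv => ?_
      rw [h2 v (mem_Ioc.1 hv).2]; ring
    rw [h3]
    simp
    ring

/-- The branching rule for Jacobi-Trudi determinants: adding a variable `z` to the entries amounts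
to adding a horizontal strip to the shape. -/
theorem det_branching {h h' : ℤ → R} {z : R} (hneg : ∀ k < 0, h k = 0) (hneg' : ∀ k < 0, h' k = 0)
    (hrec : ∀ k, h' k = h k + z * h' (k - 1)) {outer inner : Fin r → ℤ} (ho : Antitone outer)
    (hi : Antitone inner) (hio : ∀ i, inner i ≤ outer i) :
    (Matrix.of fun i j : Fin r => h' (outer i - i - (inner j - j))).det =
      ∑ ν ∈ Fintype.piFinset (fun i => Icc (stripBound outer inner i) (outer i)) with
          ∀ i, inner i ≤ ν i,
        (∏ i, z ^ (outer i - ν i).toNat) *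
          (Matrix.of fun i j : Fin r => h (ν i - i - (inner j - j))).det := by
  have hle : ∀ i, stripBound outer inner i ≤ outer i := by
    intro i
    unfold stripBound
    split_ifs with h
    · exact ho (Fin.mk_le_mk.2 (Nat.le_succ _))
    · exact hio i
  -- Subtracting a multiple of the next row truncates the row `∑ v ≤ outer i, z ^ (outer i - v) * _`
  -- to the terms with `v ≥ outer (i + 1)`.
  have h1 : (Matrix.of fun i j : Fin r => h' (outer i - i - (inner j - j))).det =
      (Matrix.of fun i j : Fin r => ∑ v ∈ Icc (stripBound outer inner i) (outer i),
        z ^ (outer i - v).toNat * h (v - i - (inner j - j))).det := by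
    refine det_eq_of_forall_row_eq_add_mul_next _ _
      (fun i => z ^ (outer i - (stripBound outer inner i - 1)).toNat) fun i j => ?_
    have := eq_sum_Ioc_of_recursion (f := fun v => h (v - i - (inner j - j)))
      (f' := fun v => h' (v - i - (inner j - j))) (z := z)
      (fun k => by rw [hrec]; congr 3; ring) (stripBound outer inner i - 1) (outer i)
      (by have := hle i; omega)
    simp only [Matrix.of_apply]
    rw [this]
    congr 1
    · refine sum_congr ?_ fun _ _ => rfl
      ext x; simp only [mem_Ioc, mem_Icc]; omega
    · congr 1
      unfold stripBound
      split_ifs with hlt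
      · congr 1; push_cast; ring
      · -- In the last row nothing remains below `inner i`, all columns having negative degree there.
        refine hneg' _ ?_
        have hj : j ≤ i := Fin.le_def.2 (by omega)
        have := hi hj
        have : (j : ℕ) ≤ i := hj
        omega
  rw [h1, det_sum_rows _ (fun i v => z ^ (outer i - v).toNat)
    (fun i v j => h (v - i - (inner j - j)))]
  -- The sequences `ν` that do not contain `inner` contribute zero determinants.
  refine (sum_subset (filter_subset _ _) fun ν hν hν' => ?_).symm
  obtain ⟨k, hk⟩ : ∃ k, ν k < inner k := by
    by_contra! hcon
    exact hν' (mem_filter.2 ⟨hν, hcon⟩)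
  have hanti : Antitone ν := by
    intro i j hij
    rcases hij.eq_or_lt with rfl | hij
    · rfl
    exact (mem_Icc.1 (Fintype.mem_piFinset.1 hν j)).2.trans (le_of_mem_strip ho
      (fun i => (mem_Icc.1 (Fintype.mem_piFinset.1 hν i)).1) hij)
  rw [det_eq_zero_of_corner _ k, mul_zero]
  intro i j hki hjk
  refine hneg _ ?_
  have h1 := hanti hki
  have h2 := hi hjk
  have h3 : (k : ℕ) ≤ i := hki
  have h4 : (j : ℕ) ≤ k := hjk
  omega

end JacobiTrudi

/-! ### Tableaux and the Jacobi-Trudi formula -/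

section Tableaux

variable {R : Type*} [CommRing R] {r : ℕ}

/-- The cells between two sequences of row lengths; the sequences are not required to form a
skew shape. -/
abbrev RowCell (outer inner : Fin r → ℤ) : Type :=
  (i : Fin r) × {j : ℤ // j ∈ Ioc (inner i) (outer i)}

/-- Semistandardness of a filling, for shapes given by their bare row sequences. -/
def IsSemistandardFilling (outer inner : Fin r → ℤ) {N : ℕ}
    (T : RowCell outer inner → Fin N) : Prop :=
  (∀ c d : RowCell outer inner, c.1 = d.1 → c.2.1 ≤ d.2.1 → T c ≤ T d) ∧
  (∀ c d : RowCell outer inner, c.1 < d.1 → c.2.1 = d.2.1 → T c < T d)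

open Classical in
/-- The generating function of the semistandard fillings, evaluated at elements `x i` of a
commutative ring. -/
noncomputable def tableauSum (outer inner : Fin r → ℤ) {N : ℕ} (x : Fin N → R) : R :=
  ∑ T : RowCell outer inner → Fin N with IsSemistandardFilling outer inner T,
    ∏ c : RowCell outer inner, x (T c)

theorem SkewShape.schur_eq_tableauSum (A : SkewShape) (N : ℕ) :
    A.schur N = tableauSum A.outer A.inner (MvPolynomial.X (R := ℤ) : Fin N → _) :=
  rfl

/-- The filling of `outer / inner` that extends the filling `T` of `ν / inner` by the largest
letter. -/
def extendByLast {outer inner : Fin r → ℤ} {N : ℕ} (ν : Fin r → ℤ)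
    (T : RowCell ν inner → Fin N) (c : RowCell outer inner) : Fin (N + 1) :=
  if h : c.2.1 ≤ ν c.1 then
    (T ⟨c.1, c.2.1, mem_Ioc.2 ⟨(mem_Ioc.1 c.2.2).1, h⟩⟩).castSucc
  else Fin.last N

theorem isSemistandardFilling_extendByLast {outer inner ν : Fin r → ℤ} {N : ℕ}
    (ho : Antitone outer) (hν : ∀ i, stripBound outer inner i ≤ ν i)
    {T : RowCell ν inner → Fin N} (hT : IsSemistandardFilling ν inner T) :
    IsSemistandardFilling outer inner (extendByLast (outer := outer) ν T) := by
  constructor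
  · rintro ⟨i, c, hc⟩ ⟨j, d, hd⟩ hij hcd
    obtain rfl : i = j := hij
    simp only at hcd
    unfold extendByLast
    by_cases h1 : d ≤ ν i
    · rw [dif_pos (hcd.trans h1), dif_pos h1]
      exact Fin.castSucc_le_castSucc_iff.2 (hT.1 _ _ rfl hcd)
    · rw [dif_neg (show ¬ d ≤ ν i from h1)]
      exact Fin.le_last _
  · rintro ⟨i, c, hc⟩ ⟨j, d, hd⟩ hij hcd
    obtain rfl : c = d := hcd
    simp only at hij
    have h0 : c ≤ ν i := (mem_Ioc.1 hd).2.trans (le_of_mem_strip ho hν hij)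
    unfold extendByLast
    rw [dif_pos h0]
    by_cases h1 : c ≤ ν j
    · rw [dif_pos h1]
      exact Fin.castSucc_lt_castSucc_iff.2 (hT.2 _ _ hij rfl)
    · rw [dif_neg (show ¬ c ≤ ν j from h1)]
      exact Fin.castSucc_lt_last _

theorem prod_extendByLast {outer inner ν : Fin r → ℤ} {N : ℕ} (x : Fin (N + 1) → R)
    (hν : ∀ i, inner i ≤ ν i) (hν' : ∀ i, ν i ≤ outer i) (T : RowCell ν inner → Fin N) :
    ∏ c : RowCell outer inner, x (extendByLast ν T c) =
      (∏ i, x (Fin.last N) ^ (outer i - ν i).toNat) * ∏ c, x (T c).castSucc := by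
  rw [Fintype.prod_sigma, Fintype.prod_sigma, ← prod_mul_distrib]
  refine prod_congr rfl fun i _ => ?_
  let g : ℤ → R := fun j => if h : j ∈ Ioc (inner i) (ν i) then x (T ⟨i, j, h⟩).castSucc
    else x (Fin.last N)
  have h1 : ∀ j : {j // j ∈ Ioc (inner i) (outer i)},
      x (extendByLast ν T ⟨i, j⟩) = g j := by
    rintro ⟨j, hj⟩
    have hj' := (mem_Ioc.1 hj).1
    by_cases h : j ≤ ν i
    · simp [g, extendByLast, h, hj']
    · simp [g, extendByLast, h]
  have h2 : ∀ j : {j // j ∈ Ioc (inner i) (ν i)}, x (T ⟨i, j⟩).castSucc = g j := by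
    rintro ⟨j, hj⟩
    simp only [g, dif_pos hj]
  rw [prod_congr rfl fun j _ => h1 j, prod_congr rfl fun j _ => h2 j,
    prod_coe_sort (Ioc (inner i) (outer i)) g, prod_coe_sort (Ioc (inner i) (ν i)) g,
    ← Ioc_union_Ioc_eq_Ioc (hν i) (hν' i), prod_union (Ioc_disjoint_Ioc_of_le le_rfl), mul_comm]
  congr 1
  have h3 : ∀ j ∈ Ioc (ν i) (outer i), g j = x (Fin.last N) := by
    intro j hj
    have : ¬ j ≤ ν i := not_le.2 (mem_Ioc.1 hj).1
    simp [g, this]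
  rw [prod_congr rfl h3, prod_const, Int.card_Ioc]

theorem extendByLast_injective {outer inner ν ν' : Fin r → ℤ} {N : ℕ}
    (hν : ∀ i, inner i ≤ ν i) (hνo : ∀ i, ν i ≤ outer i)
    (hν' : ∀ i, inner i ≤ ν' i) (hνo' : ∀ i, ν' i ≤ outer i)
    {T : RowCell ν inner → Fin N} {T' : RowCell ν' inner → Fin N}
    (h : extendByLast (outer := outer) ν T = extendByLast ν' T') :
    (⟨ν, T⟩ : (κ : Fin r → ℤ) × (RowCell κ inner → Fin N)) = ⟨ν', T'⟩ := by
  have key : ∀ (i : Fin r) (j : ℤ), inner i < j → j ≤ outer i → (j ≤ ν i ↔ j ≤ ν' i) := by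
    intro i j h1 h2
    have := congrFun h ⟨i, j, mem_Ioc.2 ⟨h1, h2⟩⟩
    unfold extendByLast at this
    by_cases h3 : j ≤ ν i <;> by_cases h4 : j ≤ ν' i
    · exact iff_of_true h3 h4
    · simp only [h3, h4, dite_true, dite_false] at this
      exact absurd this (Fin.castSucc_lt_last _).ne
    · simp only [h3, h4, dite_true, dite_false] at this
      exact absurd this.symm (Fin.castSucc_lt_last _).ne
    · exact iff_of_false h3 h4
  obtain rfl : ν = ν' := by
    funext i
    rcases lt_trichotomy (ν i) (ν' i) with hlt | heq | hlt
    · have := (key i (ν' i) ((hν i).trans_lt hlt) (hνo' i)).2 le_rfl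
      omega
    · exact heq
    · have := (key i (ν i) ((hν' i).trans_lt hlt) (hνo i)).1 le_rfl
      omega
  congr 1
  funext ⟨i, j, hj⟩
  have hj' := mem_Ioc.1 hj
  have := congrFun h ⟨i, j, mem_Ioc.2 ⟨hj'.1, hj'.2.trans (hνo i)⟩⟩
  simpa [extendByLast, hj'.2] using this

/-- Every semistandard filling arises from one with one letter less: row `i` of `ν` ends where the
largest letter begins. -/
theorem exists_extendByLast_eq {outer inner : Fin r → ℤ} {N : ℕ} (ho : Antitone outer)
    (hi : Antitone inner) (hio : ∀ i, inner i ≤ outer i)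
    {T : RowCell outer inner → Fin (N + 1)} (hT : IsSemistandardFilling outer inner T) :
    ∃ ν : Fin r → ℤ, (∀ i, stripBound outer inner i ≤ ν i) ∧ (∀ i, ν i ≤ outer i) ∧
      (∀ i, inner i ≤ ν i) ∧ ∃ T' : RowCell ν inner → Fin N,
        IsSemistandardFilling ν inner T' ∧ extendByLast ν T' = T := by
  classical
  have hex : ∀ i, ∃ n, inner i ≤ n ∧ n ≤ outer i ∧
      ∀ j (hj : j ∈ Ioc (inner i) (outer i)), j ≤ n ↔ T ⟨i, j, hj⟩ ≠ Fin.last N := by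
    intro i
    let s : Finset ℤ := insert (inner i)
      (({j | T ⟨i, j⟩ ≠ Fin.last N} : Finset {j // j ∈ Ioc (inner i) (outer i)}).image Subtype.val)
    have hs : s.Nonempty := insert_nonempty _ _
    have hmem : ∀ j, j ∈ s ↔ j = inner i ∨ ∃ hj : j ∈ Ioc (inner i) (outer i),
        T ⟨i, j, hj⟩ ≠ Fin.last N := by
      intro j; simp only [s, mem_insert, mem_image, mem_filter, mem_univ, true_and, Subtype.exists,
        exists_and_right, exists_eq_right]
    refine ⟨s.max' hs, le_max' _ _ (mem_insert_self _ _), max'_le _ _ _ fun j hj => ?_,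
      fun j hj => ⟨fun hle => ?_, fun hne => le_max' _ _ ((hmem j).2 (Or.inr ⟨hj, hne⟩))⟩⟩
    · rcases (hmem j).1 hj with rfl | ⟨hj, -⟩
      · exact hio i
      · exact (mem_Ioc.1 hj).2
    · rcases (hmem _).1 (s.max'_mem hs) with h | ⟨h, h'⟩
      · have := (mem_Ioc.1 hj).1
        omega
      · exact ((hT.1 ⟨i, j, hj⟩ ⟨i, _, h⟩ rfl hle).trans_lt (Fin.lt_last_iff_ne_last.2 h')).ne
  choose ν h1 h2 h3 using hex
  have hmem : ∀ c : RowCell ν inner, c.2.1 ∈ Ioc (inner c.1) (outer c.1) := fun c =>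
    mem_Ioc.2 ⟨(mem_Ioc.1 c.2.2).1, (mem_Ioc.1 c.2.2).2.trans (h2 c.1)⟩
  refine ⟨ν, fun i => ?_, h2, h1, fun c => (T ⟨c.1, c.2.1, hmem c⟩).castPred
    ((h3 c.1 c.2.1 (hmem c)).1 (mem_Ioc.1 c.2.2).2), ⟨?_, ?_⟩, ?_⟩
  · unfold stripBound
    split_ifs with h
    · by_contra! hlt
      have hlt' : i < (⟨i + 1, h⟩ : Fin r) := Fin.lt_def.2 (Nat.lt_succ_self _)
      -- If row `i + 1` reached beyond `ν i`, its last cell would lie below a maximal letter.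
      have hc : outer ⟨i + 1, h⟩ ∈ Ioc (inner i) (outer i) :=
        mem_Ioc.2 ⟨(h1 i).trans_lt hlt, ho hlt'.le⟩
      have hd : outer ⟨i + 1, h⟩ ∈ Ioc (inner ⟨i + 1, h⟩) (outer ⟨i + 1, h⟩) :=
        mem_Ioc.2 ⟨(hi hlt'.le).trans_lt (mem_Ioc.1 hc).1, le_rfl⟩
      have hlast : T ⟨i, _, hc⟩ = Fin.last N := by
        by_contra hne
        exact absurd ((h3 i _ hc).2 hne) (not_le.2 hlt)
      have := hT.2 ⟨i, _, hc⟩ ⟨_, _, hd⟩ hlt' rfl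
      rw [hlast] at this
      exact absurd this (not_lt.2 (Fin.le_last _))
    · exact h1 i
  · intro c d hcd hle
    exact Fin.castPred_le_castPred_iff.2 (hT.1 ⟨c.1, _, hmem c⟩ ⟨d.1, _, hmem d⟩ hcd hle)
  · intro c d hcd heq
    exact Fin.castPred_lt_castPred_iff.2 (hT.2 ⟨c.1, _, hmem c⟩ ⟨d.1, _, hmem d⟩ hcd heq)
  · funext c
    unfold extendByLast
    split_ifs with h
    · simp
    · by_contra hne
      exact h ((h3 c.1 c.2.1 c.2.2).2 (Ne.symm hne))

/-- The branching rule for tableaux: the cells that contain the largest letter form a horizontal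
strip. -/
theorem tableauSum_branching {outer inner : Fin r → ℤ} {N : ℕ} (ho : Antitone outer)
    (hi : Antitone inner) (hio : ∀ i, inner i ≤ outer i) (x : Fin (N + 1) → R) :
    tableauSum outer inner x =
      ∑ ν ∈ Fintype.piFinset (fun i => Icc (stripBound outer inner i) (outer i)) with
          ∀ i, inner i ≤ ν i,
        (∏ i, x (Fin.last N) ^ (outer i - ν i).toNat) *
          tableauSum ν inner (fun i : Fin N => x i.castSucc) := by
  classical
  simp only [tableauSum, mul_sum]
  rw [sum_sigma']
  symm
  refine sum_bij (fun p _ => extendByLast p.1 p.2) ?_ ?_ ?_ ?_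
  · rintro ⟨ν, T⟩ h
    simp only [mem_sigma, mem_filter, Fintype.mem_piFinset, mem_Icc, mem_univ, true_and] at h ⊢
    exact isSemistandardFilling_extendByLast ho (fun i => (h.1.1 i).1) h.2
  · rintro ⟨ν, T⟩ h ⟨ν', T'⟩ h' heq
    simp only [mem_sigma, mem_filter, Fintype.mem_piFinset, mem_Icc, mem_univ, true_and] at h h'
    exact extendByLast_injective h.1.2 (fun i => (h.1.1 i).2) h'.1.2 (fun i => (h'.1.1 i).2) heq
  · intro T hT
    obtain ⟨ν, h1, h2, h3, T', h4, rfl⟩ := exists_extendByLast_eq ho hi hio (mem_filter.1 hT).2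
    refine ⟨⟨ν, T'⟩, ?_, rfl⟩
    simp only [mem_sigma, mem_filter, Fintype.mem_piFinset, mem_Icc, mem_univ, true_and]
    exact ⟨⟨fun i => ⟨h1 i, h2 i⟩, h3⟩, h4⟩
  · rintro ⟨ν, T⟩ h
    simp only [mem_sigma, mem_filter, Fintype.mem_piFinset, mem_Icc, mem_univ, true_and] at h
    exact (prod_extendByLast x h.1.2 (fun i => (h.1.1 i).2) T).symm

theorem tableauSum_no_letters {outer inner : Fin r → ℤ}
    (hi : Antitone inner) (hio : ∀ i, inner i ≤ outer i) (x : Fin 0 → R) :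
    tableauSum outer inner x =
      (Matrix.of fun i j : Fin r =>
        if outer i - i - (inner j - j) = 0 then (1 : R) else 0).det := by
  classical
  rw [Matrix.det_of_isLowerTriangular]
  · by_cases h : ∀ i, outer i = inner i
    · have : IsEmpty (RowCell outer inner) := ⟨fun c => by
        have := mem_Ioc.1 c.2.2
        have := h c.1
        omega⟩
      rw [tableauSum, filter_true_of_mem]
      · simp [h]
      · intro T _
        exact ⟨fun c => isEmptyElim c, fun c => isEmptyElim c⟩
    · obtain ⟨i, hne⟩ := not_forall.1 h
      have : IsEmpty (RowCell outer inner → Fin 0) := ⟨fun T =>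
        (T ⟨i, outer i, mem_Ioc.2 ⟨(hio i).lt_of_ne (Ne.symm hne), le_rfl⟩⟩).elim0⟩
      rw [prod_eq_zero (mem_univ i)]
      · simp [tableauSum]
      · simp only [Matrix.of_apply]
        exact if_neg fun h => hne (by omega)
  · intro i j hij
    have hij : i < j := hij
    refine if_neg fun h => ?_
    have h1 := hi hij.le
    have h2 := hio i
    have hij' : (i : ℕ) < j := hij
    omega

/-- The Jacobi-Trudi formula.  All that is needed of the entries (the complete homogeneous
symmetric functions) is that they vanish in negative degrees. -/
theorem exists_tableauSum_eq_det {N : ℕ} (x : Fin N → R) :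
    ∃ h : ℤ → R, (∀ k < 0, h k = 0) ∧ ∀ (r : ℕ) (outer inner : Fin r → ℤ), Antitone outer →
      Antitone inner → (∀ i, inner i ≤ outer i) →
      tableauSum outer inner x =
        (Matrix.of fun i j : Fin r => h (outer i - i - (inner j - j))).det := by
  induction N with
  | zero =>
    refine ⟨fun k => if k = 0 then 1 else 0, fun k hk => if_neg hk.ne, fun r outer inner ho hi hio =>
      tableauSum_no_letters hi hio x⟩
  | succ N ih =>
    obtain ⟨h, hneg, hdet⟩ := ih fun i => x i.castSucc
    have hneg' : ∀ k < 0, ∑ j ∈ range (k + 1).toNat, x (Fin.last N) ^ j * h (k - j) = 0 := by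
      intro k hk
      rw [Int.toNat_of_nonpos (by omega)]
      simp
    refine ⟨fun k => ∑ j ∈ range (k + 1).toNat, x (Fin.last N) ^ j * h (k - j), hneg',
      fun r outer inner ho hi hio => ?_⟩
    rw [tableauSum_branching ho hi hio, det_branching hneg hneg' (z := x (Fin.last N)) ?_ ho hi hio]
    · refine sum_congr rfl fun ν hν => ?_
      simp only [mem_filter, Fintype.mem_piFinset, mem_Icc] at hν
      have hanti : Antitone ν := by
        intro i j hij
        rcases hij.eq_or_lt with rfl | hij
        · rfl
        · exact (hν.1 j).2.trans (le_of_mem_strip ho (fun i => (hν.1 i).1) hij)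
      rw [hdet r ν inner hanti hi hν.2]
    · intro k
      rcases lt_or_ge k 0 with hk | hk
      · rw [hneg' k hk, hneg' (k - 1) (by omega), hneg k hk]
        simp
      · have h1 : (k + 1).toNat = (k - 1 + 1).toNat + 1 := by omega
        rw [h1, sum_range_succ', mul_sum, add_comm]
        congr 1
        · simp
        · refine sum_congr rfl fun j _ => ?_
          push_cast
          rw [pow_succ, show k - ((j : ℤ) + 1) = k - 1 - j by ring]
          ring

end Tableaux

/-! ### Point sets and their minors -/

section Points

variable {R : Type*} [CommRing R]

theorem Point.upper_injective : Function.Injective Point.upper := fun _ _ h => Point.upper.inj h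

theorem Point.lower_injective : Function.Injective Point.lower := fun _ _ h => Point.lower.inj h

/-- The abscissas of the upper points of a set of points. -/
noncomputable def uppers (F : Finset Point) : Finset ℤ :=
  F.preimage Point.upper Point.upper_injective.injOn

/-- The abscissas of the lower points of a set of points. -/
noncomputable def lowers (F : Finset Point) : Finset ℤ :=
  F.preimage Point.lower Point.lower_injective.injOn

@[simp]
theorem mem_uppers {F : Finset Point} {x : ℤ} : x ∈ uppers F ↔ Point.upper x ∈ F :=
  mem_preimage

@[simp]
theorem mem_lowers {F : Finset Point} {x : ℤ} : x ∈ lowers F ↔ Point.lower x ∈ F :=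
  mem_preimage

theorem ext_uppers_lowers {F G : Finset Point} (hu : uppers F = uppers G)
    (hl : lowers F = lowers G) : F = G := by
  ext p
  cases p with
  | upper x => rw [← mem_uppers, hu, mem_uppers]
  | lower x => rw [← mem_lowers, hl, mem_lowers]

/-- The minor of the Toeplitz matrix `h (u - l)` whose rows are the upper and whose columns are the
lower points of `F`. -/
noncomputable def pointMinor (h : ℤ → R) (F : Finset Point) : R :=
  sortedMinor (fun u l => h (u - l)) (uppers F) (lowers F)

theorem SkewShape.uppers_points (A : SkewShape) :
    uppers A.points = univ.image fun i : Fin A.rows => A.outer i - ((i : ℤ) + 1) := by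
  ext x; simp [SkewShape.points]

theorem SkewShape.lowers_points (A : SkewShape) :
    lowers A.points = univ.image fun i : Fin A.rows => A.inner i - ((i : ℤ) + 1) := by
  ext x; simp [SkewShape.points]

theorem strictAnti_sub_of_antitone {r : ℕ} {f : Fin r → ℤ} (hf : Antitone f) :
    StrictAnti fun i : Fin r => f i - ((i : ℤ) + 1) := by
  intro i j hij
  have h1 := hf hij.le
  have h2 : (i : ℕ) < j := hij
  simp only
  omega

theorem antitone_add_of_strictAnti {r : ℕ} {f : Fin r → ℤ} (hf : StrictAnti f) :
    Antitone fun i : Fin r => f i + ((i : ℤ) + 1) := by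
  cases r with
  | zero => exact fun i => i.elim0
  | succ n =>
    refine Fin.antitone_iff_succ_le.2 fun i => ?_
    have := hf (Fin.castSucc_lt_succ (i := i))
    simp only [Fin.val_succ, Fin.val_castSucc]
    push_cast
    omega

theorem image_comp_rev {α : Type*} [DecidableEq α] {k : ℕ} (g : Fin k → α) :
    univ.image (g ∘ Fin.rev) = univ.image g := by
  rw [← image_image, image_univ_of_surjective Fin.rev_surjective]

theorem sortedMinor_image_of_strictAnti {α β : Type*} [LinearOrder α] [LinearOrder β]
    (H : α → β → R) {k : ℕ} {e : Fin k → α} {f : Fin k → β} (he : StrictAnti e)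
    (hf : StrictAnti f) :
    sortedMinor H (univ.image e) (univ.image f) = (Matrix.of fun i j => H (e i) (f j)).det := by
  rw [← image_comp_rev e, ← image_comp_rev f, sortedMinor_image H (he.comp Fin.rev_strictAnti) (hf.comp Fin.rev_strictAnti),
    ← Matrix.det_submatrix_equiv_self Fin.revPerm (Matrix.of fun i j => H (e i) (f j))]
  rfl

theorem SkewShape.pointMinor_points (A : SkewShape) (h : ℤ → R) :
    pointMinor h A.points =
      (Matrix.of fun i j : Fin A.rows => h (A.outer i - i - (A.inner j - j))).det := by
  rw [pointMinor, A.uppers_points, A.lowers_points, sortedMinor_image_of_strictAnti _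
    (strictAnti_sub_of_antitone A.outer_antitone) (strictAnti_sub_of_antitone A.inner_antitone)]
  congr 2
  funext i j
  congr 1
  ring

theorem SkewShape.card_uppers (A : SkewShape) : #(uppers A.points) = A.rows := by
  rw [A.uppers_points, card_image_of_injective _
    (strictAnti_sub_of_antitone A.outer_antitone).injective]
  simp

theorem SkewShape.card_lowers (A : SkewShape) : #(lowers A.points) = A.rows := by
  rw [A.lowers_points, card_image_of_injective _
    (strictAnti_sub_of_antitone A.inner_antitone).injective]
  simp

theorem SkewShape.points_injective : Function.Injective SkewShape.points := by
  have hr : ∀ {A B : SkewShape}, A.points = B.points → A.rows = B.rows := by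
    intro A B h
    rw [← A.card_uppers, h, B.card_uppers]
  have hu : ∀ {A B : SkewShape}, A.points = B.points →
      (univ.image fun i : Fin A.rows => A.outer i - ((i : ℤ) + 1)) =
        univ.image fun i : Fin B.rows => B.outer i - ((i : ℤ) + 1) := by
    intro A B h
    rw [← A.uppers_points, h, B.uppers_points]
  have hl : ∀ {A B : SkewShape}, A.points = B.points →
      (univ.image fun i : Fin A.rows => A.inner i - ((i : ℤ) + 1)) =
        univ.image fun i : Fin B.rows => B.inner i - ((i : ℤ) + 1) := by
    intro A B h
    rw [← A.lowers_points, h, B.lowers_points]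
  rintro ⟨r, o, i, ho, hi, hio⟩ ⟨r', o', i', ho', hi', hio'⟩ h
  obtain rfl : r = r' := hr h
  have key : ∀ {f g : Fin r → ℤ}, Antitone f → Antitone g →
      (univ.image fun i : Fin r => f i - ((i : ℤ) + 1)) =
        (univ.image fun i : Fin r => g i - ((i : ℤ) + 1)) → f = g := by
    intro f g hf hg hfg
    have h1 : Set.range (fun i : Fin r => f i - ((i : ℤ) + 1)) =
        Set.range fun i : Fin r => g i - ((i : ℤ) + 1) := by
      simpa using congrArg (fun s : Finset ℤ => (s : Set ℤ)) hfg
    have h2 := ((strictAnti_sub_of_antitone hf).range_inj (strictAnti_sub_of_antitone hg)).1 h1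
    funext i
    have := congrFun h2 i
    omega
  obtain rfl := key ho ho' (hu h)
  obtain rfl := key hi hi' (hl h)
  rfl

theorem exists_strictAnti_image_eq {α : Type*} [LinearOrder α] (U : Finset α) {k : ℕ}
    (h : #U = k) : ∃ e : Fin k → α, StrictAnti e ∧ univ.image e = U := by
  obtain ⟨e, he, rfl⟩ := exists_strictMono_image_eq U h
  exact ⟨e ∘ Fin.rev, he.comp_strictAnti Fin.rev_strictAnti, image_comp_rev e⟩

/-- Point sets that do not come from a skew shape have vanishing minors: if some lower point lies to
the right of the upper point of the same row, then there is a large block of zeros. -/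
theorem exists_points_eq_of_pointMinor_ne_zero {h : ℤ → R} (hneg : ∀ k < 0, h k = 0)
    {F : Finset Point} (hF : pointMinor h F ≠ 0) : ∃ A : SkewShape, A.points = F := by
  have hcard : #(uppers F) = #(lowers F) := by
    by_contra hne
    exact hF (sortedMinor_of_card_ne _ hne)
  generalize hk : #(lowers F) = k at hcard
  obtain ⟨e, he, heF⟩ := exists_strictAnti_image_eq _ hcard
  obtain ⟨f, hf, hfF⟩ := exists_strictAnti_image_eq _ hk
  rw [pointMinor, ← heF, ← hfF, sortedMinor_image_of_strictAnti _ he hf] at hF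
  refine ⟨⟨_, fun i => e i + ((i : ℤ) + 1), fun i => f i + ((i : ℤ) + 1),
    antitone_add_of_strictAnti he, antitone_add_of_strictAnti hf, fun k => ?_⟩, ?_⟩
  · by_contra! hlt
    refine hF (det_eq_zero_of_corner _ k fun i j hki hjk => hneg _ ?_)
    have h1 := he.antitone hki
    have h2 := hf.antitone hjk
    omega
  · refine ext_uppers_lowers ?_ ?_
    · rw [SkewShape.uppers_points, ← heF]
      simp
    · rw [SkewShape.lowers_points, ← hfF]
      simp

end Points

/-! ### Alternation and single recolourings -/

section ConsecutiveElements

variable {α : Type*} [LinearOrder α]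

/-- `x` and `y` are consecutive elements of the finite set `X`, in increasing order. -/
def Consecutive (X : Finset α) (x y : α) : Prop :=
  x ∈ X ∧ y ∈ X ∧ x < y ∧ ∀ z ∈ X, x < z → ¬ z < y

/-- A property that does not change between consecutive elements is constant. -/
theorem iff_of_forall_consecutive {X : Finset α} {P : α → Prop}
    (h : ∀ x y, Consecutive X x y → (P x ↔ P y)) {x y : α} (hx : x ∈ X) (hy : y ∈ X) :
    P x ↔ P y := by
  have key : ∀ n, ∀ x ∈ X, ∀ y ∈ X, x < y → #{z ∈ X | x < z ∧ z < y} = n → (P x ↔ P y) := by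
    intro n
    induction n using Nat.strong_induction_on with
    | _ n ih =>
      intro x hx y hy hxy hn
      by_cases hc : ∀ z ∈ X, x < z → ¬ z < y
      · exact h x y ⟨hx, hy, hxy, hc⟩
      · push Not at hc
        obtain ⟨z, hz, hxz, hzy⟩ := hc
        have hmem : z ∈ ({w ∈ X | x < w ∧ w < y} : Finset α) := mem_filter.2 ⟨hz, hxz, hzy⟩
        have h1 := ih #{w ∈ X | x < w ∧ w < z} (hn ▸ card_lt_card
          ⟨fun w hw => by simp only [mem_filter] at hw ⊢; exact ⟨hw.1, hw.2.1, hw.2.2.trans hzy⟩,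
            fun hs => by simpa using hs hmem⟩) x hx z hz hxz rfl
        have h2 := ih #{w ∈ X | z < w ∧ w < y} (hn ▸ card_lt_card
          ⟨fun w hw => by simp only [mem_filter] at hw ⊢; exact ⟨hw.1, hxz.trans hw.2.1, hw.2.2⟩,
            fun hs => by simpa using hs hmem⟩) z hz y hy hzy rfl
        exact h1.trans h2
  rcases lt_trichotomy x y with hxy | rfl | hxy
  · exact key _ x hx y hy hxy rfl
  · rfl
  · exact (key _ y hy x hx hxy rfl).symm

/-- If the property `I` changes between any two consecutive elements, then it is, up to a global
negation, the parity of the position. -/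
theorem parity_iff_of_forall_consecutive {X : Finset α} {I : α → Prop}
    (h : ∀ x y, Consecutive X x y → (I x ↔ ¬ I y)) {x y : α} (hx : x ∈ X) (hy : y ∈ X) :
    (Even #{z ∈ X | z < x} ↔ I x) ↔ (Even #{z ∈ X | z < y} ↔ I y) := by
  refine iff_of_forall_consecutive (P := fun x => Even #{z ∈ X | z < x} ↔ I x) ?_ hx hy
  intro x y hxy
  have h1 : ({z ∈ X | z < y} : Finset α) = insert x {z ∈ X | z < x} := by
    ext z
    simp only [mem_filter, mem_insert]
    constructor
    · rintro ⟨hz, hzy⟩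
      rcases lt_trichotomy z x with hzx | hzx | hzx
      · exact Or.inr ⟨hz, hzx⟩
      · exact Or.inl hzx
      · exact absurd hzy (hxy.2.2.2 z hz hzx)
    · rintro (rfl | ⟨hz, hzx⟩)
      · exact ⟨hxy.1, hxy.2.2.1⟩
      · exact ⟨hz, hzx.trans hxy.2.2.1⟩
  have h2 := h x y hxy
  rw [h1, card_insert_of_notMem (by simp), Nat.even_add_one]
  tauto

end ConsecutiveElements

section Recolouring

variable {R : Type*} [CommRing R]

namespace Colouring

theorem mem_coloured {c : Colouring} {p : Point} :
    p ∈ c.coloured ↔ (p ∈ c.green ↔ p ∉ c.red) := by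
  simp only [coloured, mem_union, mem_sdiff]
  tauto

theorem mem_recolour_green {c : Colouring} {F : Finset Point} {p : Point} :
    p ∈ (c.recolour F).green ↔ if p ∈ F then p ∈ c.red else p ∈ c.green := by
  simp only [recolour, mem_union, mem_sdiff, mem_inter]
  split_ifs <;> tauto

theorem mem_recolour_red {c : Colouring} {F : Finset Point} {p : Point} :
    p ∈ (c.recolour F).red ↔ if p ∈ F then p ∈ c.green else p ∈ c.red := by
  simp only [recolour, mem_union, mem_sdiff, mem_inter]
  split_ifs <;> tauto

theorem ext_mem {c c' : Colouring} (h : ∀ p, p ∈ c.green ↔ p ∈ c'.green)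
    (h' : ∀ p, p ∈ c.red ↔ p ∈ c'.red) : c = c' :=
  Colouring.ext (Finset.ext h) (Finset.ext h')

theorem coloured_recolour (c : Colouring) (F : Finset Point) :
    (c.recolour F).coloured = c.coloured := by
  ext p
  rw [mem_coloured, mem_coloured, mem_recolour_green, mem_recolour_red]
  split_ifs <;> tauto

theorem inward_recolour {c : Colouring} {F : Finset Point} {p : Point} (hp : p ∈ c.coloured) :
    (c.recolour F).Inward p ↔ (c.Inward p ↔ p ∉ F) := by
  rw [mem_coloured] at hp
  cases p <;> simp only [Inward, mem_recolour_green, mem_recolour_red] <;> split_ifs <;> tauto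

theorem recolour_empty (c : Colouring) : c.recolour ∅ = c :=
  ext_mem (by simp [mem_recolour_green]) (by simp [mem_recolour_red])

theorem recolour_insert {c : Colouring} {F : Finset Point} {y : Point} (hy : y ∉ F) :
    (c.recolour F).recolour {y} = c.recolour (insert y F) := by
  refine ext_mem (fun p => ?_) (fun p => ?_) <;>
  · by_cases h : p = y
    · subst h; simp [mem_recolour_green, mem_recolour_red, hy]
    · simp [mem_recolour_green, mem_recolour_red, h]

theorem recolour_erase {c : Colouring} {F : Finset Point} {y : Point} (hy : y ∈ F) :
    (c.recolour F).recolour {y} = c.recolour (F.erase y) := by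
  refine ext_mem (fun p => ?_) (fun p => ?_) <;>
  · by_cases h : p = y
    · subst h; simp [mem_recolour_green, mem_recolour_red, hy]
    · simp [mem_recolour_green, mem_recolour_red, h]

/-- On coloured points, a recolouring determines the set of recoloured points. -/
theorem recolour_injOn (c : Colouring) : Set.InjOn c.recolour {F | F ⊆ c.coloured} := by
  intro F hF G hG h
  have key : ∀ p ∈ c.coloured, (p ∈ F ↔ p ∈ G) := by
    intro p hp
    have h1 : p ∈ (c.recolour F).green ↔ p ∈ (c.recolour G).green := by rw [h]
    rw [mem_recolour_green, mem_recolour_green] at h1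
    rw [mem_coloured] at hp
    by_cases h2 : p ∈ F <;> by_cases h3 : p ∈ G <;> simp only [h2, h3, if_true, if_false] at h1 ⊢ <;>
      tauto
  ext p
  exact ⟨fun hp => (key p (hF hp)).1 hp, fun hp => (key p (hG hp)).2 hp⟩

/-- The colouring with green and red interchanged. -/
def swap (c : Colouring) : Colouring := ⟨c.red, c.green⟩

theorem coloured_swap (c : Colouring) : c.swap.coloured = c.coloured := by
  ext p
  rw [mem_coloured, mem_coloured, swap]
  tauto

theorem inward_swap {c : Colouring} {p : Point} (hp : p ∈ c.coloured) :
    c.swap.Inward p ↔ ¬ c.Inward p := by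
  rw [mem_coloured] at hp
  cases p <;> simp only [Inward, swap] <;> tauto

theorem swap_recolour (c : Colouring) (F : Finset Point) :
    c.swap.recolour F = (c.recolour F).swap :=
  rfl

/-- The product of the minors of the two colours. -/
noncomputable def minorProduct (h : ℤ → R) (c : Colouring) : R :=
  pointMinor h c.green * pointMinor h c.red

theorem minorProduct_swap (h : ℤ → R) (c : Colouring) :
    minorProduct h c.swap = minorProduct h c :=
  mul_comm _ _

theorem neg_one_pow_card_add_card {α : Type*} [DecidableEq α] (s t : Finset α) :
    (-1 : R) ^ (#s + #t) = (-1) ^ #((s \ t) ∪ (t \ s)) := by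
  have h1 := card_sdiff_add_card_inter s t
  have h2 := card_sdiff_add_card_inter t s
  have h3 : #((s \ t) ∪ (t \ s)) = #(s \ t) + #(t \ s) :=
    card_union_of_disjoint (disjoint_sdiff_sdiff)
  rw [inter_comm] at h2
  have h4 : #s + #t = #((s \ t) ∪ (t \ s)) + 2 * #(s ∩ t) := by omega
  rw [h4, pow_add, pow_mul]
  simp

theorem disjoint_map_upper_map_lower (s t : Finset ℤ) :
    Disjoint (s.map ⟨Point.upper, Point.upper_injective⟩)
      (t.map ⟨Point.lower, Point.lower_injective⟩) := by
  rw [disjoint_left]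
  intro p hp hp'
  simp only [mem_map, Function.Embedding.coeFn_mk] at hp hp'
  obtain ⟨x, -, rfl⟩ := hp
  obtain ⟨y, -, hy⟩ := hp'
  exact Point.noConfusion hy

open Classical in
theorem filter_not_inward (c : Colouring) :
    ({y ∈ c.coloured | ¬ c.Inward y} : Finset Point) =
      (uppers c.red \ uppers c.green).map ⟨Point.upper, Point.upper_injective⟩ ∪
      (lowers c.green \ lowers c.red).map ⟨Point.lower, Point.lower_injective⟩ := by
  ext p
  rw [mem_filter, mem_coloured]
  cases p <;> simp [Inward] <;> tauto

open Classical in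
/-- If each colour has as many upper as lower points, then the two orientations are equally
frequent. -/
theorem card_inward_eq_card_outward {c : Colouring} (hg : #(uppers c.green) = #(lowers c.green))
    (hr : #(uppers c.red) = #(lowers c.red)) :
    #{p ∈ c.coloured | c.Inward p} = #{p ∈ c.coloured | ¬ c.Inward p} := by
  have h1 : ({p ∈ c.coloured | c.Inward p} : Finset Point) =
      {p ∈ c.swap.coloured | ¬ c.swap.Inward p} := by
    rw [coloured_swap]
    exact filter_congr fun p hp => by simp [inward_swap hp]
  rw [h1, filter_not_inward, filter_not_inward,
    card_union_of_disjoint (disjoint_map_upper_map_lower _ _),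
    card_union_of_disjoint (disjoint_map_upper_map_lower _ _), card_map, card_map, card_map,
    card_map]
  simp only [swap]
  have h1 := card_sdiff_add_card_inter (uppers c.green) (uppers c.red)
  have h2 := card_sdiff_add_card_inter (uppers c.red) (uppers c.green)
  have h3 := card_sdiff_add_card_inter (lowers c.green) (lowers c.red)
  have h4 := card_sdiff_add_card_inter (lowers c.red) (lowers c.green)
  rw [inter_comm] at h2 h4
  omega

open Classical in
/-- Reversing single outwards oriented points: the alternating sum of the products of minors
vanishes, the sign being the parity of the position on the circle. -/
theorem sum_outward_recolour (h : ℤ → R) (c : Colouring) (heven : Even #c.coloured) :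
    ∑ y ∈ c.coloured with ¬ c.Inward y,
      (-1) ^ #{z ∈ c.coloured | z < y} * minorProduct h (c.recolour {y}) = 0 := by
  have hsignU : ∀ u, (-1 : R) ^ #{z ∈ c.coloured | z < Point.upper u} =
      (-1) ^ (#{x ∈ uppers c.green | x < u} + #{x ∈ uppers c.red | x < u}) := by
    intro u
    rw [neg_one_pow_card_add_card]
    congr 1
    rw [← card_map ⟨Point.upper, Point.upper_injective⟩]
    congr 1
    ext p
    cases p with
    | upper x =>
      by_cases hx : x < u
      · simp [mem_coloured, Point.upper_lt_upper, hx]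
        tauto
      · simp [Point.upper_lt_upper, hx]
    | lower x =>
      have : ¬ Point.lower x < Point.upper u := not_lt.2 Point.upper_lt_lower.le
      simp [this]
  have hsignL : ∀ l, Point.lower l ∈ c.coloured →
      (-1 : R) ^ #{z ∈ c.coloured | z < Point.lower l} =
      - (-1) ^ (#{x ∈ lowers c.green | x < l} + #{x ∈ lowers c.red | x < l}) := by
    intro l hl
    rw [neg_one_pow_card_add_card]
    have h1 : #(({x ∈ lowers c.green | x < l} \ {x ∈ lowers c.red | x < l}) ∪
        ({x ∈ lowers c.red | x < l} \ {x ∈ lowers c.green | x < l})) =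
        #{z ∈ c.coloured | Point.lower l < z} := by
      rw [← card_map ⟨Point.lower, Point.lower_injective⟩]
      congr 1
      ext p
      cases p with
      | lower x =>
        by_cases hx : x < l
        · simp [mem_coloured, Point.lower_lt_lower, hx]
          tauto
        · simp [Point.lower_lt_lower, hx]
      | upper x =>
        have : ¬ Point.lower l < Point.upper x := not_lt.2 Point.upper_lt_lower.le
        simp [this]
    -- Lower points are read from right to left. As the number of coloured points is even, counting
    -- from the other end changes the sign.
    have h2 : #{z ∈ c.coloured | z < Point.lower l} + #{z ∈ c.coloured | Point.lower l < z} + 1 =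
        #c.coloured := by
      rw [← card_union_of_disjoint, ← card_erase_add_one hl]
      · congr 2
        ext p
        simp only [mem_union, mem_filter, mem_erase, ← lt_or_lt_iff_ne]
        tauto
      · exact disjoint_filter.2 fun p _ h1 h2 => lt_asymm h1 h2
    rw [h1]
    have h3 : (-1 : R) ^ #{z ∈ c.coloured | z < Point.lower l} *
        (-1) ^ #{z ∈ c.coloured | Point.lower l < z} = -1 := by
      rw [← pow_add, Odd.neg_one_pow]
      rw [← h2, Nat.even_add_one, Nat.not_even_iff_odd] at heven
      exact heven
    have h4 : (-1 : R) ^ #{z ∈ c.coloured | Point.lower l < z} *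
        (-1) ^ #{z ∈ c.coloured | Point.lower l < z} = 1 := by
      rw [← mul_pow]; simp
    linear_combination (-1 : R) ^ #{z ∈ c.coloured | Point.lower l < z} * h3 -
      (-1 : R) ^ #{z ∈ c.coloured | z < Point.lower l} * h4
  rw [filter_not_inward, sum_union (disjoint_map_upper_map_lower _ _), sum_map, sum_map]
  have hex := sortedMinor_exchange (fun u l => h (u - l)) (uppers c.green) (uppers c.red)
    (lowers c.green) (lowers c.red)
  rw [← sub_eq_zero, sub_eq_add_neg, ← sum_neg_distrib] at hex
  rw [← hex]
  congr 1
  · refine sum_congr rfl fun u hu => ?_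
    simp only [mem_sdiff, mem_uppers] at hu
    simp only [Function.Embedding.coeFn_mk]
    rw [hsignU]
    congr 1
    unfold minorProduct pointMinor
    congr 2 <;> ext x <;> simp [mem_recolour_green, mem_recolour_red] <;>
      by_cases hx : x = u <;> simp_all
  · refine sum_congr rfl fun l hl => ?_
    simp only [mem_sdiff, mem_lowers] at hl
    simp only [Function.Embedding.coeFn_mk]
    rw [hsignL l (mem_coloured.2 (by tauto)), neg_mul]
    congr 2
    unfold minorProduct pointMinor
    congr 2 <;> ext x <;> simp [mem_recolour_green, mem_recolour_red] <;>
      by_cases hx : x = l <;> simp_all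

open Classical in
/-- The same relation for the points of either orientation. -/
theorem sum_oriented_recolour (h : ℤ → R) (c : Colouring) (heven : Even #c.coloured) (b : Prop) :
    ∑ y ∈ c.coloured with ¬ (c.Inward y ↔ b),
      (-1) ^ #{z ∈ c.coloured | z < y} * minorProduct h (c.recolour {y}) = 0 := by
  by_cases hb : b
  · simpa [hb] using sum_outward_recolour h c heven
  · have := sum_outward_recolour h c.swap (by rwa [coloured_swap])
    rw [coloured_swap] at this
    rw [← this]
    refine sum_congr (filter_congr fun p hp => ?_) fun p _ => ?_
    · simp [hb, inward_swap hp]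
    · rw [swap_recolour, minorProduct_swap]

end Colouring

end Recolouring

/-! ### The sum over all recolourings -/

section DoubleCounting

/-- A sum over all sets of size `k + 1`, each of them being counted once for each of its
elements. -/
theorem sum_powersetCard_sum_insert {α M : Type*} [DecidableEq α] [AddCommMonoid M] (s : Finset α)
    (k : ℕ) (f : Finset α → M) :
    ∑ T ∈ powersetCard k s, ∑ y ∈ s \ T, f (insert y T) =
      (k + 1) • ∑ T ∈ powersetCard (k + 1) s, f T := by
  rw [smul_sum]
  have h1 : ∀ T ∈ powersetCard (k + 1) s, (k + 1) • f T = ∑ _y ∈ T, f T := by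
    intro T hT
    rw [sum_const, (mem_powersetCard.1 hT).2]
  rw [sum_congr rfl h1, sum_sigma', sum_sigma']
  refine sum_bij' (fun p _ => ⟨insert p.2 p.1, p.2⟩) (fun p _ => ⟨p.1.erase p.2, p.2⟩) ?_ ?_ ?_ ?_ ?_
  · rintro ⟨T, y⟩ h
    simp only [mem_sigma, mem_powersetCard, mem_sdiff] at h ⊢
    exact ⟨⟨insert_subset h.2.1 h.1.1, by rw [card_insert_of_notMem h.2.2, h.1.2]⟩,
      mem_insert_self _ _⟩
  · rintro ⟨T, y⟩ h
    simp only [mem_sigma, mem_powersetCard, mem_sdiff] at h ⊢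
    exact ⟨⟨(erase_subset _ _).trans h.1.1, by rw [card_erase_of_mem h.2, h.1.2]; rfl⟩,
      h.1.1 h.2, notMem_erase _ _⟩
  · rintro ⟨T, y⟩ h
    simp only [mem_sigma, mem_sdiff] at h
    simp [erase_insert h.2.2]
  · rintro ⟨T, y⟩ h
    simp only [mem_sigma] at h
    simp [insert_erase h.2]
  · rintro ⟨T, y⟩ h
    rfl

end DoubleCounting

namespace Colouring

variable {R : Type*} [CommRing R]

open Classical in
/-- The coloured points whose orientation is inwards if `b` holds and outwards if not. -/
noncomputable def oriented (c : Colouring) (b : Prop) : Finset Point :=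
  {p ∈ c.coloured | c.Inward p ↔ b}

theorem mem_oriented {c : Colouring} {b : Prop} {p : Point} :
    p ∈ c.oriented b ↔ p ∈ c.coloured ∧ (c.Inward p ↔ b) := by
  simp [oriented]

theorem disjoint_oriented (c : Colouring) (b : Prop) :
    Disjoint (c.oriented b) (c.oriented (¬ b)) := by
  rw [disjoint_left]
  intro p hp hp'
  rw [mem_oriented] at hp hp'
  tauto

/-- For an alternating orientation, the parity of the position of a coloured point is determined by
its orientation. -/
theorem exists_sign {c : Colouring}
    (halt : ∀ p q, Consecutive c.coloured p q → (c.Inward p ↔ ¬ c.Inward q)) (b : Prop) :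
    ∃ ε : R, ε * ε = 1 ∧ (∀ y ∈ c.oriented b, (-1) ^ #{z ∈ c.coloured | z < y} = ε) ∧
      ∀ y ∈ c.oriented (¬ b), (-1) ^ #{z ∈ c.coloured | z < y} = -ε := by
  obtain ⟨q, hq⟩ : ∃ q : Prop, ∀ y ∈ c.coloured,
      ((Even #{z ∈ c.coloured | z < y} ↔ c.Inward y) ↔ q) := by
    rcases c.coloured.eq_empty_or_nonempty with h | ⟨x, hx⟩
    · exact ⟨True, by simp [h]⟩
    · exact ⟨_, fun y hy => parity_iff_of_forall_consecutive halt hy hx⟩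
  by_cases hbq : b ↔ q
  · refine ⟨1, by simp, fun y hy => ?_, fun y hy => ?_⟩
    · rw [mem_oriented] at hy
      have := hq y hy.1
      exact Even.neg_one_pow (by tauto)
    · rw [mem_oriented] at hy
      have := hq y hy.1
      exact Odd.neg_one_pow (Nat.not_even_iff_odd.1 (by tauto))
  · refine ⟨-1, by simp, fun y hy => ?_, fun y hy => ?_⟩
    · rw [mem_oriented] at hy
      have := hq y hy.1
      exact Odd.neg_one_pow (Nat.not_even_iff_odd.1 (by tauto))
    · rw [mem_oriented] at hy
      have := hq y hy.1
      rw [neg_neg]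
      exact Even.neg_one_pow (by tauto)

/-- For an alternating orientation all signs in the exchange relation agree. -/
theorem sum_recolour_insert_eq_sum_recolour_erase (h : ℤ → R) {c : Colouring}
    (heven : Even #c.coloured)
    (halt : ∀ p q, Consecutive c.coloured p q → (c.Inward p ↔ ¬ c.Inward q)) {b : Prop}
    {W T : Finset Point} (hW : W ⊆ c.oriented b) (hT : T ⊆ c.oriented (¬ b)) :
    ∑ y ∈ c.oriented (¬ b) \ T, minorProduct h (c.recolour (W ∪ insert y T)) =
      ∑ y ∈ W, minorProduct h (c.recolour (W.erase y ∪ T)) := by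
  classical
  obtain ⟨ε, hε, hown, hother⟩ := exists_sign (R := R) halt b
  have hrel := sum_oriented_recolour h (c.recolour (W ∪ T)) (by rwa [coloured_recolour]) b
  have hset : ({y ∈ c.coloured | ¬ ((c.recolour (W ∪ T)).Inward y ↔ b)} : Finset Point) =
      (c.oriented (¬ b) \ T) ∪ W := by
    ext y
    rw [mem_filter, mem_union, mem_sdiff, mem_oriented]
    have h1 := fun hy : y ∈ W => mem_oriented.1 (hW hy)
    have h2 := fun hy : y ∈ T => mem_oriented.1 (hT hy)
    by_cases hy : y ∈ c.coloured
    · rw [inward_recolour hy, mem_union]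
      tauto
    · tauto
  have hdisj : Disjoint (c.oriented (¬ b) \ T) W :=
    (disjoint_of_subset_left hW
      (disjoint_of_subset_right sdiff_subset (c.disjoint_oriented b))).symm
  rw [coloured_recolour, hset, sum_union hdisj] at hrel
  have h1 : ∀ y ∈ c.oriented (¬ b) \ T, (-1) ^ #{z ∈ c.coloured | z < y} *
      minorProduct h ((c.recolour (W ∪ T)).recolour {y}) =
      -ε * minorProduct h (c.recolour (W ∪ insert y T)) := by
    intro y hy
    rw [hother y (mem_sdiff.1 hy).1, recolour_insert, union_insert]
    rw [mem_union, not_or]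
    exact ⟨disjoint_left.1 hdisj hy, (mem_sdiff.1 hy).2⟩
  have h2 : ∀ y ∈ W, (-1) ^ #{z ∈ c.coloured | z < y} *
      minorProduct h ((c.recolour (W ∪ T)).recolour {y}) =
      ε * minorProduct h (c.recolour (W.erase y ∪ T)) := by
    intro y hy
    have hyT : y ∉ T := fun hyT => disjoint_left.1 (c.disjoint_oriented b) (hW hy) (hT hyT)
    rw [hown y (hW hy), recolour_erase (mem_union_left _ hy), erase_union_distrib,
      erase_eq_of_notMem hyT]
  rw [sum_congr rfl h1, sum_congr rfl h2, ← mul_sum, ← mul_sum] at hrel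
  linear_combination (-ε) * hrel + (∑ y ∈ W, minorProduct h (c.recolour (W.erase y ∪ T)) -
    ∑ y ∈ c.oriented (¬ b) \ T, minorProduct h (c.recolour (W ∪ insert y T))) * hε

/-- For an alternating orientation and a set `W` of equally oriented points, the product of minors
is the sum of the products that arise by reversing `W` and equally many points of the opposite
orientation.  By induction on `W`, as every such recolouring is obtained from `#W` smaller sets. -/
theorem minorProduct_eq_sum_recolour [IsDomain R] [CharZero R] (h : ℤ → R) {c : Colouring}
    (heven : Even #c.coloured)
    (halt : ∀ p q, Consecutive c.coloured p q → (c.Inward p ↔ ¬ c.Inward q)) {b : Prop}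
    {W : Finset Point} (hW : W ⊆ c.oriented b) :
    minorProduct h c =
      ∑ T ∈ powersetCard #W (c.oriented (¬ b)), minorProduct h (c.recolour (W ∪ T)) := by
  generalize hk : #W = k
  induction k generalizing W with
  | zero =>
    rw [card_eq_zero.1 hk]
    simp [recolour_empty]
  | succ k ih =>
    have h1 := sum_powersetCard_sum_insert (c.oriented (¬ b)) k
      fun T => minorProduct h (c.recolour (W ∪ T))
    rw [sum_congr rfl fun T hT => sum_recolour_insert_eq_sum_recolour_erase h heven halt hW
      (mem_powersetCard.1 hT).1, sum_comm] at h1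
    have h2 : ∀ y ∈ W, ∑ T ∈ powersetCard k (c.oriented (¬ b)),
        minorProduct h (c.recolour (W.erase y ∪ T)) = minorProduct h c := by
      intro y hy
      refine (ih ((erase_subset _ _).trans hW) ?_).symm
      rw [card_erase_of_mem hy, hk]
      rfl
    rw [sum_congr rfl h2, sum_const, hk] at h1
    exact smul_right_injective R (Nat.succ_ne_zero k) h1

end Colouring

/-! ### Noncrossing matchings of alternating points -/

section Matchings

theorem Consecutive.lt_or_lt {α : Type*} [LinearOrder α] {X : Finset α} {x y z : α}
    (h : Consecutive X x y) (hz : z ∈ X) (hx : z ≠ x) (hy : z ≠ y) : z < x ∨ y < z := by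
  by_contra! hcon
  exact h.2.2.2 z hz (hcon.1.lt_of_ne hx.symm) (hcon.2.lt_of_ne hy)

/-- Removing two consecutive elements preserves alternation. -/
theorem alternating_erase_erase {α : Type*} [LinearOrder α] {X : Finset α} {I : α → Prop}
    (h : ∀ p q, Consecutive X p q → (I p ↔ ¬ I q)) {x y : α} (hxy : Consecutive X x y) :
    ∀ p q, Consecutive ((X.erase x).erase y) p q → (I p ↔ ¬ I q) := by
  rintro p q ⟨hp, hq, hpq, hno⟩
  simp only [mem_erase] at hp hq hno
  by_cases hbetween : p < x ∧ y < q
  · have h1 : Consecutive X p x := ⟨hp.2.2, hxy.1, hbetween.1, fun z hz hpz hzx =>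
      hno z ⟨(hzx.trans hxy.2.2.1).ne, hzx.ne, hz⟩ hpz (hzx.trans (hxy.2.2.1.trans hbetween.2))⟩
    have h2 : Consecutive X y q := ⟨hxy.2.1, hq.2.2, hbetween.2, fun z hz hyz hzq =>
      hno z ⟨hyz.ne', (hxy.2.2.1.trans hyz).ne', hz⟩
        (hbetween.1.trans (hxy.2.2.1.trans hyz)) hzq⟩
    have h1 := h _ _ h1
    have h2 := h _ _ h2
    have h3 := h _ _ hxy
    tauto
  · refine h p q ⟨hp.2.2, hq.2.2, hpq, fun z hz hpz hzq => ?_⟩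
    have h1 := hxy.lt_or_lt hp.2.2 hp.2.1 hp.1
    have h2 := hxy.lt_or_lt hq.2.2 hq.2.1 hq.1
    have h3 := hxy.2.2.1
    have h4 : z = x ∨ z = y := by
      by_contra! hne
      exact hno z ⟨hne.2, hne.1, hz⟩ hpz hzq
    apply hbetween
    rcases h4 with rfl | rfl
    · exact ⟨hpz, h2.resolve_left hzq.not_gt⟩
    · exact ⟨h1.resolve_right hpz.not_gt, hzq⟩

theorem card_filter_erase_erase {α : Type*} [DecidableEq α] {X : Finset α} {x y : α} (hx : x ∈ X) (hy : y ∈ X)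
    (hxy : x ≠ y) (P : α → Prop) [DecidablePred P] :
    #{p ∈ X | P p} = #{p ∈ (X.erase x).erase y | P p} +
      ((if P x then 1 else 0) + if P y then 1 else 0) := by
  rw [card_filter, card_filter, ← add_sum_erase X _ hx,
    ← add_sum_erase (X.erase x) _ (mem_erase.2 ⟨hxy.symm, hy⟩)]
  omega

open Classical in
/-- An alternating set with as many points, and as many marked (`s`) points, of either orientation has
two consecutive points that are both marked or both unmarked.  Otherwise "inwards and marked, or
outwards and unmarked" would be a constant property. -/
theorem exists_consecutive_iff {α : Type*} [LinearOrder α] {X : Finset α} {I s : α → Prop}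
    (halt : ∀ p q, Consecutive X p q → (I p ↔ ¬ I q)) (hX : X.Nonempty)
    (hI : #{p ∈ X | I p} = #{p ∈ X | ¬ I p})
    (hs : #{p ∈ X | s p ∧ I p} = #{p ∈ X | s p ∧ ¬ I p}) :
    ∃ x y, Consecutive X x y ∧ (s x ↔ s y) := by
  by_contra! hcon
  obtain ⟨p₀, hp₀⟩ := hX
  have hconst : ∀ p ∈ X, ((I p ↔ s p) ↔ (I p₀ ↔ s p₀)) := fun p hp =>
    iff_of_forall_consecutive (P := fun p => I p ↔ s p) (fun x y hxy => by
      have h1 := halt x y hxy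
      have h2 := hcon x y hxy
      tauto) hp hp₀
  have hempty : (∀ p ∈ X, ¬ I p) ∨ ∀ p ∈ X, ¬ ¬ I p := by
    by_cases h0 : I p₀ ↔ s p₀
    · have h1 : #{p ∈ X | s p ∧ ¬ I p} = 0 := by
        rw [card_eq_zero, filter_eq_empty_iff]
        intro p hp
        have := hconst p hp
        tauto
      rw [h1, card_eq_zero, filter_eq_empty_iff] at hs
      refine Or.inl fun p hp => ?_
      have := hconst p hp
      have := hs hp
      tauto
    · have h1 : #{p ∈ X | s p ∧ I p} = 0 := by
        rw [card_eq_zero, filter_eq_empty_iff]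
        intro p hp
        have := hconst p hp
        tauto
      rw [h1, eq_comm, card_eq_zero, filter_eq_empty_iff] at hs
      refine Or.inr fun p hp => ?_
      have := hconst p hp
      have := hs hp
      tauto
  rcases hempty with h | h
  · rw [filter_eq_empty_iff.2 fun p hp => h p hp, card_empty, eq_comm, card_eq_zero,
      filter_eq_empty_iff] at hI
    exact hI hp₀ (h p₀ hp₀)
  · rw [filter_eq_empty_iff.2 fun p hp => h p hp, card_empty, card_eq_zero,
      filter_eq_empty_iff] at hI
    exact h p₀ hp₀ (hI hp₀)

open Classical in
/-- Noncrossing matchings of an alternating set of points exist with prescribed sets of equally many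
marked points of either orientation that are matched with each other: two consecutive points may
be joined, and are removed. -/
theorem exists_noncrossing_matching {I s : Point → Prop} (X : Finset Point)
    (halt : ∀ p q, Consecutive X p q → (I p ↔ ¬ I q))
    (hI : #{p ∈ X | I p} = #{p ∈ X | ¬ I p})
    (hs : #{p ∈ X | s p ∧ I p} = #{p ∈ X | s p ∧ ¬ I p}) :
    ∃ m : Point → Point, (∀ p ∈ X, m p ∈ X ∧ m (m p) = p ∧ (I p ↔ ¬ I (m p)) ∧ (s p ↔ s (m p))) ∧
      ∀ p ∈ X, ∀ q ∈ X, ¬ (Clockwise p q (m p) ∧ Clockwise (m p) (m q) p) := by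
  generalize hn : #X = n
  induction n using Nat.strong_induction_on generalizing X with
  | _ n ih =>
    rcases X.eq_empty_or_nonempty with rfl | hX
    · exact ⟨id, by simp, by simp⟩
    obtain ⟨x, y, hxy, hsxy⟩ := exists_consecutive_iff halt hX hI hs
    have hne : x ≠ y := hxy.2.2.1.ne
    have hIxy := halt x y hxy
    have hcard : #((X.erase x).erase y) < n := by
      rw [← hn]
      exact (card_le_card (erase_subset _ _)).trans_lt (card_erase_lt_of_mem hxy.1)
    have hI' : #{p ∈ (X.erase x).erase y | I p} = #{p ∈ (X.erase x).erase y | ¬ I p} := by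
      rw [card_filter_erase_erase hxy.1 hxy.2.1 hne,
        card_filter_erase_erase hxy.1 hxy.2.1 hne fun p => ¬ I p] at hI
      by_cases h1 : I x <;> by_cases h2 : I y <;> simp [h1, h2] at hI hIxy <;> omega
    have hs' : #{p ∈ (X.erase x).erase y | s p ∧ I p} =
        #{p ∈ (X.erase x).erase y | s p ∧ ¬ I p} := by
      rw [card_filter_erase_erase hxy.1 hxy.2.1 hne fun p => s p ∧ I p,
        card_filter_erase_erase hxy.1 hxy.2.1 hne fun p => s p ∧ ¬ I p] at hs
      by_cases h1 : I x <;> by_cases h2 : I y <;> by_cases h3 : s x <;> by_cases h4 : s y <;>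
        simp [h1, h2, h3, h4] at hs hIxy hsxy <;> omega
    obtain ⟨m, hm, hcross⟩ := ih _ hcard _ (alternating_erase_erase halt hxy) hI' hs' rfl
    have hmem : ∀ p, p ∈ (X.erase x).erase y ↔ p ≠ y ∧ p ≠ x ∧ p ∈ X := by simp
    let m' : Point → Point := fun p => if p = x then y else if p = y then x else m p
    have hm'x : m' x = y := if_pos rfl
    have hm'y : m' y = x := by simp [m', hne.symm]
    have hm' : ∀ p, p ≠ x → p ≠ y → m' p = m p := fun p h1 h2 => by simp [m', h1, h2]
    have hcases : ∀ p ∈ X, p = x ∨ p = y ∨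
        (p ∈ (X.erase x).erase y ∧ m p ∈ (X.erase x).erase y ∧ m' p = m p) := by
      intro p hp
      by_cases h1 : p = x
      · exact Or.inl h1
      by_cases h2 : p = y
      · exact Or.inr (Or.inl h2)
      · have hp' := (hmem p).2 ⟨h2, h1, hp⟩
        exact Or.inr (Or.inr ⟨hp', (hm p hp').1, hm' p h1 h2⟩)
    have hout : ∀ p ∈ (X.erase x).erase y, p < x ∨ y < p := fun p hp =>
      hxy.lt_or_lt ((hmem p).1 hp).2.2 ((hmem p).1 hp).2.1 ((hmem p).1 hp).1
    have hlt := hxy.2.2.1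
    have hno : ∀ p ∈ X, ¬ Clockwise x p y := by
      intro p hp hcw
      have := hxy.2.2.2 p hp
      unfold Clockwise at hcw
      grind
    have hmX : ∀ p ∈ X, m' p ∈ X := by
      intro p hp
      rcases hcases p hp with rfl | rfl | ⟨-, h, heq⟩
      · rw [hm'x]; exact hxy.2.1
      · rw [hm'y]; exact hxy.1
      · rw [heq]; exact ((hmem _).1 h).2.2
    refine ⟨m', fun p hp => ⟨hmX p hp, ?_⟩, fun p hp q hq => ?_⟩
    · rcases hcases p hp with rfl | rfl | ⟨h1, h2, heq⟩
      · rw [hm'x, hm'y]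
        exact ⟨rfl, hIxy, hsxy⟩
      · rw [hm'y, hm'x]
        exact ⟨rfl, by tauto, hsxy.symm⟩
      · rw [heq, hm' _ ((hmem _).1 h2).2.1 ((hmem _).1 h2).1]
        exact (hm p h1).2
    · rcases hcases p hp with rfl | rfl | ⟨hp1, hp2, hpm⟩
      · rw [hm'x]
        exact fun h => hno q hq h.1
      · rw [hm'y]
        exact fun h => hno _ (hmX q hq) h.2
      · have h1 := hout p hp1
        have h2 := hout _ hp2
        rw [hpm]
        rcases hcases q hq with rfl | rfl | ⟨hq1, hq2, hqm⟩
        · rw [hm'x]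
          unfold Clockwise
          grind
        · rw [hm'y]
          unfold Clockwise
          grind
        · rw [hqm]
          exact hcross p hp1 q hq1

end Matchings

namespace Colouring

theorem Alternating.iff_of_consecutive {c : Colouring} (halt : c.Alternating) (p q : Point)
    (hpq : Consecutive c.coloured p q) : c.Inward p ↔ ¬ c.Inward q := by
  refine halt p hpq.1 q hpq.2.1 hpq.2.2.1.ne fun r hr hcw => ?_
  have h1 := hpq.2.2.2 r hr
  have h2 := hpq.2.2.1
  unfold Clockwise at hcw
  grind

/-- For an alternating orientation, the Dodgson recolouring scheme for `S` reverses, besides `S`, an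
arbitrary set of `#S` points of the opposite orientation. -/
theorem dodgsonStep_iff {c : Colouring} (halt : c.Alternating)
    (hg : #(uppers c.green) = #(lowers c.green)) (hr : #(uppers c.red) = #(lowers c.red))
    {b : Prop} {S : Finset Point} (hS : S ⊆ c.oriented b) {c' : Colouring} :
    c.DodgsonStep S c' ↔
      ∃ T ∈ powersetCard #S (c.oriented (¬ b)), c' = c.recolour (S ∪ T) := by
  classical
  constructor
  · rintro ⟨m, hm, rfl⟩
    refine ⟨S.image m, mem_powersetCard.2 ⟨fun q hq => ?_, ?_⟩, rfl⟩
    · obtain ⟨p, hp, rfl⟩ := mem_image.1 hq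
      have h1 := mem_oriented.1 (hS hp)
      have h2 := hm.oriented p h1.1
      exact mem_oriented.2 ⟨hm.mem p h1.1, by tauto⟩
    · refine card_image_of_injOn fun p hp q hq hpq => ?_
      rw [← hm.involutive p (mem_oriented.1 (hS hp)).1, hpq,
        hm.involutive q (mem_oriented.1 (hS hq)).1]
  · rintro ⟨T, hT, rfl⟩
    obtain ⟨hT, hcard⟩ := mem_powersetCard.1 hT
    have h1 : ∀ b' : Prop, (b' ↔ b) →
        #{p ∈ c.coloured | p ∈ S ∪ T ∧ (c.Inward p ↔ b')} = #S := by
      intro b' hb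
      congr 1
      ext p
      rw [mem_filter, mem_union]
      have h2 := fun hp : p ∈ S => mem_oriented.1 (hS hp)
      have h3 := fun hp : p ∈ T => mem_oriented.1 (hT hp)
      tauto
    have h1' : ∀ b' : Prop, (b' ↔ ¬ b) →
        #{p ∈ c.coloured | p ∈ S ∪ T ∧ (c.Inward p ↔ b')} = #S := by
      intro b' hb
      rw [← hcard]
      congr 1
      ext p
      rw [mem_filter, mem_union]
      have h2 := fun hp : p ∈ S => mem_oriented.1 (hS hp)
      have h3 := fun hp : p ∈ T => mem_oriented.1 (hT hp)
      tauto
    have hs : #{p ∈ c.coloured | p ∈ S ∪ T ∧ c.Inward p} =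
        #{p ∈ c.coloured | p ∈ S ∪ T ∧ ¬ c.Inward p} := by
      by_cases hb : b
      · have h2 := h1 True (by simpa using hb)
        have h3 := h1' False (by simpa using hb)
        simp only [iff_true, iff_false] at h2 h3
        rw [h2, h3]
      · have h2 := h1' True (by simpa using hb)
        have h3 := h1 False (by simpa using hb)
        simp only [iff_true, iff_false] at h2 h3
        rw [h2, h3]
    obtain ⟨m, hm, hcross⟩ := exists_noncrossing_matching (s := fun p => p ∈ S ∪ T) c.coloured
      halt.iff_of_consecutive (card_inward_eq_card_outward hg hr) (by convert hs)
    have himage : S.image m = T := by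
      refine eq_of_subset_of_card_le (fun q hq => ?_) ?_
      · obtain ⟨p, hp, rfl⟩ := mem_image.1 hq
        have h2 := mem_oriented.1 (hS hp)
        obtain ⟨-, -, h3, h4⟩ := hm p h2.1
        have h5 := fun hp : m p ∈ S => mem_oriented.1 (hS hp)
        simp only [mem_union] at h4
        tauto
      · rw [hcard, card_image_of_injOn]
        intro p hp q hq hpq
        rw [← (hm p (mem_oriented.1 (hS hp)).1).2.1, hpq,
          (hm q (mem_oriented.1 (hS hq)).1).2.1]
    exact ⟨m, ⟨fun p hp => (hm p hp).1, fun p hp => (hm p hp).2.1, fun p hp => (hm p hp).2.2.1,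
      hcross⟩, by rw [himage]⟩

end Colouring

/-! ### The product of two skew Schur functions -/

theorem colouringOf_injective :
    Function.Injective fun P : SkewShape × SkewShape => colouringOf P.1 P.2 := by
  rintro ⟨A, B⟩ ⟨A', B'⟩ h
  have h := Colouring.mk.inj h
  exact Prod.ext (SkewShape.points_injective h.1) (SkewShape.points_injective h.2)

theorem SkewShape.exists_schur_eq_pointMinor (N : ℕ) :
    ∃ h : ℤ → MvPolynomial (Fin N) ℤ, (∀ k < 0, h k = 0) ∧
      ∀ A : SkewShape, A.schur N = pointMinor h A.points := by
  obtain ⟨h, hneg, hdet⟩ := exists_tableauSum_eq_det (MvPolynomial.X (R := ℤ) : Fin N → _)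
  refine ⟨h, hneg, fun A => ?_⟩
  rw [A.schur_eq_tableauSum, A.pointMinor_points,
    hdet _ _ _ A.outer_antitone A.inner_antitone A.inner_le_outer]

theorem exists_colouringOf_eq_of_minorProduct_ne_zero {R : Type*} [CommRing R] {h : ℤ → R}
    (hneg : ∀ k < 0, h k = 0) {c : Colouring} (hc : c.minorProduct h ≠ 0) :
    ∃ P : SkewShape × SkewShape, colouringOf P.1 P.2 = c := by
  obtain ⟨A, hA⟩ := exists_points_eq_of_pointMinor_ne_zero hneg (left_ne_zero_of_mul hc)
  obtain ⟨B, hB⟩ := exists_points_eq_of_pointMinor_ne_zero hneg (right_ne_zero_of_mul hc)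
  exact ⟨(A, B), Colouring.ext hA hB⟩

end SkewOverlay

open SkewOverlay in
theorem mainTheorem7 (A B : SkewOverlay.SkewShape)
    (halt : (SkewOverlay.colouringOf A B).Alternating)
    (S : Finset SkewOverlay.Point) (hSne : S.Nonempty)
    (hS : S ⊆ (SkewOverlay.colouringOf A B).coloured)
    (hSor : ∀ p ∈ S, ∀ q ∈ S,
      ((SkewOverlay.colouringOf A B).Inward p ↔ (SkewOverlay.colouringOf A B).Inward q)) :
    ∃ hQ : (SkewOverlay.dodgsonPairs A B S).Finite, ∀ N : ℕ,
      A.schur N * B.schur N = ∑ P ∈ hQ.toFinset, P.1.schur N * P.2.schur N := by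
  classical
  obtain ⟨p₀, hp₀⟩ := hSne
  have hSb : S ⊆ (colouringOf A B).oriented ((colouringOf A B).Inward p₀) := fun p hp =>
    Colouring.mem_oriented.2 ⟨hS hp, hSor p hp p₀ hp₀⟩
  have hg : (uppers (colouringOf A B).green).card = (lowers (colouringOf A B).green).card :=
    A.card_uppers.trans A.card_lowers.symm
  have hr : (uppers (colouringOf A B).red).card = (lowers (colouringOf A B).red).card :=
    B.card_uppers.trans B.card_lowers.symm
  generalize (colouringOf A B).Inward p₀ = b at hSb
  have hstep := fun c' => Colouring.dodgsonStep_iff halt hg hr hSb (c' := c')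
  set 𝒯 := Finset.powersetCard S.card ((colouringOf A B).oriented (¬ b))
  have hmem : ∀ P : SkewShape × SkewShape, P ∈ dodgsonPairs A B S ↔
      colouringOf P.1 P.2 ∈ 𝒯.image fun T => (colouringOf A B).recolour (S ∪ T) := by
    intro P
    rw [Finset.mem_image]
    simp only [dodgsonPairs, Set.mem_ofPred_eq, hstep, eq_comm]
  have hQ : (dodgsonPairs A B S).Finite :=
    ((Finset.finite_toSet _).preimage colouringOf_injective.injOn).subset fun P hP =>
      Finset.mem_coe.2 ((hmem P).1 hP)
  refine ⟨hQ, fun N => ?_⟩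
  obtain ⟨h, hneg, hschur⟩ := SkewShape.exists_schur_eq_pointMinor N
  have heven : Even (colouringOf A B).coloured.card := by
    rw [← Finset.card_filter_add_card_filter_not (s := (colouringOf A B).coloured)
      (p := (colouringOf A B).Inward), Colouring.card_inward_eq_card_outward hg hr]
    exact ⟨_, rfl⟩
  have hinj : Set.InjOn (fun T => (colouringOf A B).recolour (S ∪ T)) 𝒯 := by
    intro T hT T' hT' heq
    have hsub : ∀ T ∈ 𝒯, T ⊆ (colouringOf A B).oriented (¬ b) := fun T hT =>
      (Finset.mem_powersetCard.1 hT).1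
    have hcol : ∀ T ∈ 𝒯, S ∪ T ⊆ (colouringOf A B).coloured := fun T hT =>
      Finset.union_subset hS fun p hp => (Colouring.mem_oriented.1 (hsub T hT hp)).1
    have hdisj : ∀ T ∈ 𝒯, Disjoint T S := fun T hT =>
      (Finset.disjoint_of_subset_left hSb (Finset.disjoint_of_subset_right (hsub T hT)
        (Colouring.disjoint_oriented _ b))).symm
    have hunion : S ∪ T = S ∪ T' :=
      Colouring.recolour_injOn _ (hcol T hT) (hcol T' hT') heq
    rw [← Finset.union_sdiff_cancel_left (hdisj T hT).symm, hunion,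
      Finset.union_sdiff_cancel_left (hdisj T' hT').symm]
  calc A.schur N * B.schur N = (colouringOf A B).minorProduct h := by
        rw [hschur, hschur]; rfl
    _ = ∑ T ∈ 𝒯, ((colouringOf A B).recolour (S ∪ T)).minorProduct h :=
        Colouring.minorProduct_eq_sum_recolour h heven halt.iff_of_consecutive hSb
    _ = ∑ c ∈ 𝒯.image fun T => (colouringOf A B).recolour (S ∪ T), c.minorProduct h :=
        (Finset.sum_image hinj).symm
    _ = ∑ c ∈ hQ.toFinset.image fun P => colouringOf P.1 P.2, c.minorProduct h := by
        symm
        refine Finset.sum_subset (fun c hc => ?_) fun c hc hc' => ?_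
        · obtain ⟨P, hP, rfl⟩ := Finset.mem_image.1 hc
          exact (hmem P).1 (hQ.mem_toFinset.1 hP)
        · -- Recolourings that do not give a pair of shapes do not contribute.
          by_contra hne
          obtain ⟨P, rfl⟩ := exists_colouringOf_eq_of_minorProduct_ne_zero hneg hne
          exact hc' (Finset.mem_image.2 ⟨P, hQ.mem_toFinset.2 ((hmem P).2 hc), rfl⟩)
    _ = ∑ P ∈ hQ.toFinset, P.1.schur N * P.2.schur N := by
        rw [Finset.sum_image colouringOf_injective.injOn]
        refine Finset.sum_congr rfl fun P _ => ?_
        rw [hschur, hschur]; rfl
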